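/- Let $\mathbb K\subset\mathbb R$ be an algebraic extension of $\mathbb Q$, and let $n_1,n_2,m,q$ be positive integers with $1<n_1<m$, $\gcd(m,n_1)=1$, $n_2>1$, $\gcd(q,n_2)=1$. Let $f\in\mathbb K[x,y]$ be a polynomial whose complex germ at the origin is irreducible with two Puiseux pairs, of characteristic sequence $(n_1n_2,\,mn_2,\,mn_2+q)$ (it has a Puiseux root $x=\varphi(y^{1/(n_1n_2)})$ with these characteristic exponents, and $f(x,0)$ has order $n_1n_2$), and whose algebraic monodromy (on $H_1$ of the Milnor fibre at the origin) has pairwise distinct eigenvalues. Let $g\in\mathbb R[x,y]$ have characteristic sequence $(n_1,m)$ at the origin and maximal contact (intersection multiplicity) with $f$ among all branches of characteristic sequence $(n_1,m)$. Let $Y\in\mathbb K[t]$ be an $n_1$-th power in $\mathbb R[t]$ such that either $\operatorname{ord}_x g(x,Y(x^{1/m}))>\frac{mn_1n_2+q}{mn_2}$ and $Y$ is monotonically increasing on $\mathbb R_{\ge 0}$, or $Y\equiv 1$. Put $$\mathcal D_Y=\{(x,y)\in\mathbb R^2: 0\le x\le 1,\ 0\le y\le Y(x^{1/m})\},\qquad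 g_Y(x,y)=\prod_{\zeta^m=1}\bigl(y-Y(\zeta x^{1/m})\bigr),$$ and assume $f>0$ on $\mathcal D_Y\setminus\{(0,0)\}$. For integers $\beta_1,\beta_2\ge 1$, $\beta_3\ge 0$ let $\mathcal I(f,\beta_1,\beta_2,\beta_3)(s)$ denote the meromorphic continuation to $\mathbb C$ of $$\iint_{\mathcal D_Y} f(x,y)^s\,x^{\beta_1}y^{\beta_2}\,g_Y(x,y)^{\beta_3}\,\frac{dx}{x}\frac{dy}{y},\qquad \operatorname{Re}s\gg 0 .$$ Let $b_f(s)\in\mathbb C[s]$ be the Bernstein–Sato polynomial of $f$: the monic generator of the ideal of all $B\in\mathbb C[s]$ for which there is a differential operator $P$ in $\partial_x,\partial_y$ with coefficients in $\mathbb C[x,y][s]$ such that $P\cdot f^{s+1}=B(s)f^s$ in $\mathbb C[x,y][1/f,s]f^s$. Suppose that $\alpha\in\mathbb C$ is a pole of $\mathcal I(f,\beta_1,\beta_2,\beta_3)(s)$, for some $\beta_1,\beta_2\ge1$, $\beta_3\ge0$, with residue transcendental over $\mathbb Q$, and that $\alpha+1$ is not a pole of $\mathcal I(f,\beta_1',\beta_2',\beta_3')(s)$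 for any integers $\beta_1',\beta_2'\ge 1$, $\beta_3'\ge 0$. Then $b_f(\alpha)=0$. -/

import Mathlib

open Filter Topology MeasureTheory Polynomial CategoryTheory

noncomputable section

namespace BernsteinTwoPairs

/-! ### The Bernstein-Sato polynomial of a complex polynomial in two variables -/

/-- The coefficient ring `ℂ[x, y]`, with `x = X 0` and `y = X 1`. -/
abbrev R : Type := MvPolynomial (Fin 2) ℂ

/-- The ring `ℂ[x, y][1/f]`. -/
abbrev Loc (f : R) : Type := Localization.Away f

/-- The ring homomorphism `p ↦ p + (∂p/∂xᵢ) ε` from `ℂ[x, y]` to `ℂ[x, y][1/f][ε]/(ε²)`. -/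
def dualHom (f : R) (i : Fin 2) : R →+* DualNumber (Loc f) where
  toFun p := TrivSqZeroExt.inl (algebraMap R (Loc f) p) +
    TrivSqZeroExt.inr (algebraMap R (Loc f) (MvPolynomial.pderiv i p))
  map_one' := by
    ext <;> simp
  map_zero' := by
    ext <;> simp
  map_mul' p q := by
    ext
    · simp
    · simp only [Derivation.leibniz, smul_eq_mul, map_add, map_mul, TrivSqZeroExt.snd_add,
        TrivSqZeroExt.snd_inl, TrivSqZeroExt.snd_inr, zero_add, TrivSqZeroExt.snd_mul,
        TrivSqZeroExt.fst_add, TrivSqZeroExt.fst_inl, TrivSqZeroExt.fst_inr, add_zero,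
        MulOpposite.smul_eq_mul_unop, MulOpposite.unop_op]
      ring
  map_add' p q := by
    ext <;> simp [← Algebra.algebraMap_eq_smul_one]

theorem isUnit_dualHom (f : R) (i : Fin 2) : IsUnit (dualHom f i f) := by
  rw [TrivSqZeroExt.isUnit_iff_isUnit_fst]
  simpa [dualHom] using IsLocalization.Away.algebraMap_isUnit (S := Loc f) f

/-- The extension of `dualHom` to `ℂ[x, y][1/f]`. -/
def locDualHom (f : R) (i : Fin 2) : Loc f →+* DualNumber (Loc f) :=
  IsLocalization.Away.lift f (isUnit_dualHom f i)

theorem locDualHom_algebraMap (f : R) (i : Fin 2) (p : R) :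
    locDualHom f i (algebraMap R (Loc f) p) = dualHom f i p :=
  IsLocalization.Away.lift_eq f (isUnit_dualHom f i) p

theorem locDualHom_fst (f : R) (i : Fin 2) (a : Loc f) : (locDualHom f i a).fst = a := by
  have h : ((TrivSqZeroExt.fstHom (Loc f) (Loc f) (Loc f)).toRingHom.comp (locDualHom f i)) =
      RingHom.id (Loc f) := by
    apply IsLocalization.ringHom_ext (Submonoid.powers f)
    ext p <;> simp [locDualHom_algebraMap, dualHom]
  exact congrArg (fun φ : Loc f →+* Loc f => φ a) h

/-- The partial derivative `∂/∂xᵢ` on `ℂ[x, y][1/f]`. -/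
def locPartial (f : R) (i : Fin 2) (a : Loc f) : Loc f := (locDualHom f i a).snd

theorem locPartial_algebraMap (f : R) (i : Fin 2) (p : R) :
    locPartial f i (algebraMap R (Loc f) p) =
      algebraMap R (Loc f) (MvPolynomial.pderiv i p) := by
  simp [locPartial, locDualHom_algebraMap, dualHom, ← Algebra.algebraMap_eq_smul_one]

theorem locPartial_add (f : R) (i : Fin 2) (a b : Loc f) :
    locPartial f i (a + b) = locPartial f i a + locPartial f i b := by
  simp [locPartial]

theorem locPartial_zero (f : R) (i : Fin 2) : locPartial f i 0 = 0 := by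
  simp [locPartial]

theorem locPartial_mul (f : R) (i : Fin 2) (a b : Loc f) :
    locPartial f i (a * b) = a * locPartial f i b + b * locPartial f i a := by
  simp [locPartial, locDualHom_fst, mul_comm]

/-- The action of `∂/∂xᵢ` on the free `ℂ[x, y][1/f, s]`-module of rank one with generator `f ^ s`.
The element `u • f ^ s` is represented by `u : ℂ[x, y][1/f][s]`, so that
`∂ᵢ (u • f ^ s) = (∂ᵢ u + s (∂ᵢ f / f) u) • f ^ s`. -/
def nabla (f : R) (i : Fin 2) (u : (Loc f)[X]) : (Loc f)[X] :=
  (u.sum fun k c => Polynomial.monomial k (locPartial f i c)) +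
    Polynomial.X * Polynomial.C (algebraMap R (Loc f) (MvPolynomial.pderiv i f) *
      IsLocalization.Away.invSelf f) * u

/-- A differential operator `∑ a_{j, i₁, i₂}(x, y) s ^ j ∂₀ ^ i₁ ∂₁ ^ i₂`, given by its
coefficients `∑ⱼ a_{j, i₁, i₂} s ^ j ∈ ℂ[x, y][s]`, applied to `u • f ^ s`. -/
def applyOp (f : R) (P : ℕ × ℕ →₀ R[X]) (u : (Loc f)[X]) : (Loc f)[X] :=
  P.sum fun I c => c.map (algebraMap R (Loc f)) * (nabla f 0)^[I.1] ((nabla f 1)^[I.2] u)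

/-- The ideal of all `B ∈ ℂ[s]` for which there is a differential operator `P` with coefficients
in `ℂ[x, y][s]` such that `P • f ^ (s + 1) = B(s) • f ^ s`. -/
def bernsteinIdeal (f : R) : Ideal ℂ[X] where
  carrier := {B | ∃ P : ℕ × ℕ →₀ R[X],
    applyOp f P (Polynomial.C (algebraMap R (Loc f) f)) = B.map (algebraMap ℂ (Loc f))}
  zero_mem' := ⟨0, by simp [applyOp]⟩
  add_mem' := by
    rintro B C ⟨P, hP⟩ ⟨Q, hQ⟩
    refine ⟨P + Q, ?_⟩
    rw [Polynomial.map_add, ← hP, ← hQ]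
    unfold applyOp
    exact Finsupp.sum_add_index' (by simp) (by intros; simp [add_mul])
  smul_mem' := by
    rintro B C ⟨P, hP⟩
    refine ⟨P.mapRange (fun c => B.map (algebraMap ℂ R) * c) (by simp), ?_⟩
    rw [smul_eq_mul, Polynomial.map_mul, ← hP]
    unfold applyOp
    rw [Finsupp.sum_mapRange_index (by simp), Finsupp.mul_sum]
    refine Finsupp.sum_congr fun I _ => ?_
    rw [Polynomial.map_mul, Polynomial.map_map, ← IsScalarTower.algebraMap_eq, mul_assoc]

/-- The Bernstein-Sato polynomial `b_f`: the monic generator of `bernsteinIdeal f`. -/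
def bernsteinSato (f : R) : ℂ[X] :=
  normalize (Submodule.IsPrincipal.generator (bernsteinIdeal f))

/-! ### Characteristic sequences and maximal contact -/

/-- `CharExponents φ n [β₁, …, β_g]`: the characteristic exponents of `x = φ(t)`, `y = t ^ n` are
`β₁, …, β_g`, that is, with `e₀ = n` and `e_k = gcd(e_{k-1}, β_k)`, each `β_k` is the least exponent
in the support of `φ` that `e_{k-1}` does not divide, and `e_g = 1`. -/
def CharExponents (φ : PowerSeries ℂ) : ℕ → List ℕ → Prop
  | e, [] => e = 1
  | e, β :: βs =>
      IsLeast {i : ℕ | PowerSeries.coeff i φ ≠ 0 ∧ ¬ e ∣ i} β ∧ CharExponents φ (Nat.gcd e β) βs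

/-- The restriction `f(φ(t), t ^ n)` of `f` to a parametrized curve. -/
def restrict (f : R) (φ : PowerSeries ℂ) (n : ℕ) : PowerSeries ℂ :=
  MvPolynomial.aeval ![φ, PowerSeries.X ^ n] f

/-- The germ of `f` at the origin has characteristic sequence `(n, β₁, …, β_g)`, and
`x = φ(y ^ (1/n))` is a Puiseux root of it. As `f(x, 0)` has order `n` and the parametrization
`(φ(t), t ^ n)` is primitive, the germ of `f` is, up to a unit, the irreducible germ
`∏_{ζ ^ n = 1} (x - φ(ζ y ^ (1/n)))`. -/
structure IsCharRoot (f : R) (n : ℕ) (β : List ℕ) (φ : PowerSeries ℂ) : Prop where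
  pos : 0 < n
  order_eq : (MvPolynomial.aeval ![(PowerSeries.X : PowerSeries ℂ), 0] f).order = n
  constantCoeff_eq : PowerSeries.constantCoeff φ = 0
  root : restrict f φ n = 0
  exponents : CharExponents φ n β

/-- The germ of `f` at the origin is irreducible with characteristic sequence `(n, β₁, …, β_g)`. -/
def HasCharSequence (f : R) (n : ℕ) (β : List ℕ) : Prop :=
  ∃ φ : PowerSeries ℂ, IsCharRoot f n β φ

/-- The germ of `g` has characteristic sequence `(n, β)`, and its intersection multiplicity with `f`
at the origin (the order of `f` along a parametrization) is maximal among all branches with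
characteristic sequence `(n, β)`. -/
def HasMaximalContact (f g : R) (n : ℕ) (β : List ℕ) : Prop :=
  ∃ ψ : PowerSeries ℂ, IsCharRoot g n β ψ ∧
    ∀ ψ' : PowerSeries ℂ, PowerSeries.constantCoeff ψ' = 0 → CharExponents ψ' n β →
      (restrict f ψ' n).order ≤ (restrict f ψ n).order

/-! ### The algebraic monodromy -/

/-- The fibre over `c` of `f` in the closed ball of radius `ε` in `ℂ²`. -/
def fibre (f : R) (ε : ℝ) (c : ℂ) : Set (ℂ × ℂ) :=
  {p | ‖p.1‖ ^ 2 + ‖p.2‖ ^ 2 ≤ ε ^ 2 ∧ MvPolynomial.eval ![p.1, p.2] f = c}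

/-- `h` is a geometric monodromy of the fibration `f` over the circle of radius `δ`: the end of a
continuous lift, starting at the inclusion of the fibre over `δ`, of the loop
`θ ↦ δ exp(2πiθ)`. -/
def IsGeometricMonodromy (f : R) (ε δ : ℝ) (h : C(fibre f ε δ, fibre f ε δ)) : Prop :=
  ∃ Φ : unitInterval × fibre f ε δ → ℂ × ℂ, Continuous Φ ∧
    (∀ z, Φ (0, z) = z) ∧
    (∀ (θ : unitInterval) z, Φ (θ, z) ∈ fibre f ε (δ * Complex.exp (2 * Real.pi * Complex.I * (θ : ℝ)))) ∧
    ∀ z, Φ (1, z) = h z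

/-- The first singular homology `H₁(T; ℂ)`. -/
def H1 (T : Type) [TopologicalSpace T] : ModuleCat.{0} ℂ :=
  ((AlgebraicTopology.singularHomologyFunctor (ModuleCat.{0} ℂ) 1).obj
    (ModuleCat.of ℂ ℂ)).obj (TopCat.of T)

/-- The endomorphism of `H₁(T; ℂ)` induced by a continuous self-map of `T`. -/
def H1map {T : Type} [TopologicalSpace T] (h : C(T, T)) : H1 T →ₗ[ℂ] H1 T :=
  (((AlgebraicTopology.singularHomologyFunctor (ModuleCat.{0} ℂ) 1).obj
    (ModuleCat.of ℂ ℂ)).map (TopCat.ofHom h)).hom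

/-- The algebraic monodromy of the Milnor fibre of `f` at the origin has pairwise distinct
eigenvalues: for `0 < δ ≪ ε ≪ 1` the homology `H₁` of the fibre has a finite basis of
eigenvectors of the monodromy whose eigenvalues are pairwise distinct. -/
def MonodromyHasDistinctEigenvalues (f : R) : Prop :=
  ∀ᶠ ε : ℝ in 𝓝[>] 0, ∀ᶠ δ : ℝ in 𝓝[>] 0,
    ∃ h : C(fibre f ε δ, fibre f ε δ), IsGeometricMonodromy f ε δ h ∧
      ∃ (μ : ℕ) (b : Module.Basis (Fin μ) ℂ (H1 (fibre f ε δ))) (ev : Fin μ → ℂ),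
        Function.Injective ev ∧ ∀ i, H1map h (b i) = ev i • b i

/-! ### The integrals -/

/-- The domain `D_Y = {(x, y) | 0 ≤ x ≤ 1, 0 ≤ y ≤ Y(x ^ (1/m))}`. -/
def domainD (m : ℕ) (Y : ℝ[X]) : Set (ℝ × ℝ) :=
  {p | 0 ≤ p.1 ∧ p.1 ≤ 1 ∧ 0 ≤ p.2 ∧ p.2 ≤ Y.eval (p.1 ^ ((1 : ℝ) / m))}

/-- `g_Y(x, y) = ∏_{ζ ^ m = 1} (y - Y(ζ x ^ (1/m)))`, for `x ≥ 0`. -/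
def gY (m : ℕ) (Y : ℝ[X]) (p : ℝ × ℝ) : ℂ :=
  ∏ ζ ∈ Polynomial.nthRootsFinset m (1 : ℂ),
    ((p.2 : ℂ) - Polynomial.aeval (ζ * ((p.1 ^ ((1 : ℝ) / m) : ℝ) : ℂ)) Y)

/-- The integrand `f ^ s x ^ β₁ y ^ β₂ g_Y ^ β₃ / (x y)`. -/
def integrand (f : MvPolynomial (Fin 2) ℝ) (m : ℕ) (Y : ℝ[X]) (β₁ β₂ β₃ : ℕ) (s : ℂ)
    (p : ℝ × ℝ) : ℂ :=
  ((MvPolynomial.eval ![p.1, p.2] f : ℝ) : ℂ) ^ s * (p.1 : ℂ) ^ β₁ * (p.2 : ℂ) ^ β₂ *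
    gY m Y p ^ β₃ / ((p.1 : ℂ) * (p.2 : ℂ))

/-- `F` is the meromorphic continuation to `ℂ` of the integral `I(f, β₁, β₂, β₃)(s)` over `D_Y`,
which is absolutely convergent for `Re s` large. -/
def IsContinuation (f : MvPolynomial (Fin 2) ℝ) (m : ℕ) (Y : ℝ[X]) (β₁ β₂ β₃ : ℕ)
    (F : ℂ → ℂ) : Prop :=
  Meromorphic F ∧ ∃ σ : ℝ, ∀ s : ℂ, σ < s.re →
    IntegrableOn (integrand f m Y β₁ β₂ β₃ s) (domainD m Y) ∧
      F s = ∫ p in domainD m Y, integrand f m Y β₁ β₂ β₃ s p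

/-- `F` has a pole at `α`. -/
def HasPole (F : ℂ → ℂ) (α : ℂ) : Prop := meromorphicOrderAt F α < 0

/-- The residue of `F` at `α` is `ρ`. -/
def HasResidue (F : ℂ → ℂ) (α ρ : ℂ) : Prop :=
  Tendsto (fun r : ℝ => (2 * Real.pi * Complex.I)⁻¹ * ∮ z in C(α, r), F z) (𝓝[>] 0) (𝓝 ρ)

/-- The complexification of a real polynomial. -/
def toC (f : MvPolynomial (Fin 2) ℝ) : R := MvPolynomial.map (algebraMap ℝ ℂ) f

end BernsteinTwoPairs

end

/-!
The argument is by contradiction: if `b_f(α) ≠ 0`, then every residue at `α` is algebraic.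

Suppose the generator of `bernsteinIdeal f` does not vanish at `α`. It comes with a functional
equation `P f ^ (s + 1) = B(s) f ^ s`. After clearing denominators this is a system of linear
equations with algebraic coefficients for the coefficients of `P` and `B`, so a suitable
`ℚ̄`-linear form `ℂ → ℚ̄` turns it into a functional equation with algebraic coefficients and still
`B(α) ≠ 0` (`exists_algebraic_functional_equation`). In particular, neither the existence of a
nonzero Bernstein-Sato polynomial nor the rationality of its roots is needed: if the ideal is zero,
so is its generator.

Integrate the functional equation against a polynomial weight `w` over `D_Y`, which the map
`(t, v) ↦ (t ^ m, v Y(t))` parametrizes by the unit square. Integration by parts moves all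
derivatives to the weight, and
`B(s) ∫ w f ^ s = ∑ k, s ^ k ∫ w_k f ^ (s + 1) + A(s)`,
where `A` collects boundary integrals (`exists_integrated_functional_equation`). A boundary
integral is `∫₀¹ p(t) ^ s Q(t) dt` for polynomials with algebraic coefficients, `p` being positive
on `(0, 1]`. Writing `p = t ^ k p₁` and integrating by parts, one finds that it continues to a
meromorphic function with simple poles at rational points `z`, the residue there being
`p₁(0) ^ (z - a)` times an algebraic number (`hasAlgCont_integral_cpow`). So poles and residues of
`A` are algebraic.

Solving for `∫ w f ^ s` continues all the integrals to `ℂ` without a resolution of singularities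
(`exists_meromorphic_continuation`). The weights `w_k` are combinations of monomials, so by
hypothesis the integrals on the right have no pole at `α + 1`, and the residue of `∫ w f ^ s` at `α`
is that of `A` divided by `B(α)`, an algebraic number (`isAlgebraic_residue`). The weight `w` may be
`x ^ (β₁ - 1) y ^ (β₂ - 1) g_Y ^ β₃`, because `g_Y` is a polynomial in `x` and `y` (`ev_gPoly`).

The parametrization requires `Y > 0` on `(0, 1]`. A monotone `Y` without this property either
vanishes identically or is negative at `0`; then `D_Y` is a null set or avoids the origin, and the
integral has no poles at all (`not_hasPole_of_degenerate`).
-/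

namespace BernsteinTwoPairs

/-! ### Simple poles with algebraic data -/

/-- The field of complex numbers algebraic over `ℚ`. -/
noncomputable abbrev Qbar : IntermediateField ℚ ℂ := algebraicClosure ℚ ℂ

/-- `F` has at most a simple pole at `z`, with residue `r`; the value of `F` at `z` is ignored.
For `r = 0` this says that the singularity of `F` at `z` is removable. -/
def SimplePoleAt (F : ℂ → ℂ) (z r : ℂ) : Prop :=
  ∃ g : ℂ → ℂ, AnalyticAt ℂ g z ∧ F =ᶠ[𝓝[≠] z] fun s => r / (s - z) + g s

namespace SimplePoleAt

variable {F G : ℂ → ℂ} {z r r' : ℂ}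

theorem congr (h : SimplePoleAt F z r) (e : G =ᶠ[𝓝[≠] z] F) : SimplePoleAt G z r := by
  obtain ⟨g, hg, h⟩ := h
  exact ⟨g, hg, e.trans h⟩

theorem _root_.AnalyticAt.simplePoleAt (h : AnalyticAt ℂ F z) : SimplePoleAt F z 0 :=
  ⟨F, h, by filter_upwards with s; simp⟩

theorem add (hF : SimplePoleAt F z r) (hG : SimplePoleAt G z r') :
    SimplePoleAt (fun s => F s + G s) z (r + r') := by
  obtain ⟨g, hg, h⟩ := hF
  obtain ⟨g', hg', h'⟩ := hG
  refine ⟨fun s => g s + g' s, hg.add hg', ?_⟩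
  filter_upwards [h, h'] with s hs hs'
  rw [hs, hs']
  ring

theorem analytic_mul {p : ℂ → ℂ} (hp : AnalyticAt ℂ p z) (hF : SimplePoleAt F z r) :
    SimplePoleAt (fun s => p s * F s) z (p z * r) := by
  obtain ⟨g, hg, h⟩ := hF
  have hd : AnalyticAt ℂ (dslope p z) z := by
    obtain ⟨q, hq⟩ := hp
    exact ⟨_, hq.has_fpower_series_dslope_fslope⟩
  refine ⟨fun s => r * dslope p z s + p s * g s, by fun_prop, ?_⟩
  filter_upwards [h, self_mem_nhdsWithin] with s hs hne
  have hne' : s - z ≠ 0 := sub_ne_zero.2 hne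
  rw [hs, dslope_of_ne _ hne, slope_def_field]
  field_simp
  ring

theorem comp_add {c : ℂ} (hF : SimplePoleAt F (z + c) r) :
    SimplePoleAt (fun s => F (s + c)) z r := by
  obtain ⟨g, hg, h⟩ := hF
  refine ⟨fun s => g (s + c), ?_, ?_⟩
  · exact AnalyticAt.fun_comp hg (by fun_prop)
  · have ht : Tendsto (fun s : ℂ => s + c) (𝓝[≠] z) (𝓝[≠] (z + c)) := by
      refine tendsto_nhdsWithin_iff.2 ⟨?_, ?_⟩
      · exact (continuous_add_const c).continuousAt.tendsto.mono_left nhdsWithin_le_nhds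
      · filter_upwards [self_mem_nhdsWithin] with s hs
        simpa using hs
    filter_upwards [ht.eventually h] with s hs
    rw [hs]
    ring_nf

theorem meromorphicAt (hF : SimplePoleAt F z r) : MeromorphicAt F z := by
  obtain ⟨g, hg, h⟩ := hF
  refine MeromorphicAt.congr ?_ h.symm
  have := hg.meromorphicAt
  fun_prop

theorem not_hasPole (hF : SimplePoleAt F z 0) : ¬ HasPole F z := by
  obtain ⟨g, hg, h⟩ := hF
  rw [HasPole, meromorphicOrderAt_congr (f₂ := g) (by simpa using h), not_lt]
  exact hg.meromorphicOrderAt_nonneg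

theorem of_not_hasPole (hF : MeromorphicAt F z) (h : ¬ HasPole F z) : SimplePoleAt F z 0 := by
  have h1 := (hF.meromorphicOrderAt_nonneg_iff_analyticAt_toMeromorphicNFAt).1 (not_lt.1 h)
  exact h1.simplePoleAt.congr hF.eq_nhdsNE_toMeromorphicNFAt

/-- The quotient of an analytic function by a linear function vanishing at `z`. -/
theorem div_linear {p : ℂ → ℂ} (hp : AnalyticAt ℂ p z) {a b : ℂ} (ha : a ≠ 0) (hz : a * z + b = 0) :
    SimplePoleAt (fun s => p s / (a * s + b)) z (p z / a) := by
  have h1 : SimplePoleAt (fun s => 1 / (a * s + b)) z (1 / a) := by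
    refine ⟨fun _ => 0, analyticAt_const, ?_⟩
    filter_upwards [self_mem_nhdsWithin] with s hne
    have hne' : s - z ≠ 0 := sub_ne_zero.2 hne
    have : a * s + b = a * (s - z) := by linear_combination hz
    rw [this]
    field_simp
    simp
  convert h1.analytic_mul hp using 1
  · ext s; ring
  · ring

theorem residue_unique {ρ : ℂ} (hF : SimplePoleAt F z r) (h : HasResidue F z ρ) : ρ = r := by
  obtain ⟨g, hg, he⟩ := hF
  refine tendsto_nhds_unique h ?_
  refine tendsto_const_nhds.congr' ?_
  obtain ⟨ε, hε, hgε⟩ := Metric.eventually_nhds_iff_ball.1 hg.eventually_analyticAt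
  rw [Filter.EventuallyEq, eventually_nhdsWithin_iff] at he
  obtain ⟨ε', hε', heε⟩ := Metric.eventually_nhds_iff_ball.1 he
  filter_upwards [Ioo_mem_nhdsGT (lt_min hε hε')] with t ht
  have ht0 : 0 < t := ht.1
  have htε : t < ε := ht.2.trans_le (min_le_left _ _)
  have htε' : t < ε' := ht.2.trans_le (min_le_right _ _)
  have hgd : DifferentiableOn ℂ g (Metric.closedBall z t) := fun w hw =>
    (hgε w (Metric.closedBall_subset_ball htε hw)).differentiableAt.differentiableWithinAt
  have h1 : (∮ w in C(z, t), F w) = ∮ w in C(z, t), (r * (w - z)⁻¹ + g w) := by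
    refine circleIntegral.integral_congr ht0.le fun w hw => ?_
    rw [heε w (Metric.closedBall_subset_ball htε' (Metric.sphere_subset_closedBall hw)) ?_,
      div_eq_mul_inv]
    rintro rfl
    simp [ht0.ne] at hw
  have hci : CircleIntegrable (fun w => r * (w - z)⁻¹) z t := by
    refine ContinuousOn.circleIntegrable ht0.le ?_
    refine continuousOn_const.mul (ContinuousOn.inv₀ (by fun_prop) fun w hw => ?_)
    rw [sub_ne_zero]
    rintro rfl
    simp [ht0.ne] at hw
  have h2 : (∮ w in C(z, t), g w) = 0 := by
    refine Complex.circleIntegral_eq_zero_of_differentiable_on_off_countable ht0.le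
      Set.countable_empty hgd.continuousOn fun w hw => ?_
    exact (hgε w (Metric.ball_subset_ball htε.le hw.1)).differentiableAt
  rw [h1, circleIntegral.integral_add hci
    ((hgd.continuousOn.mono Metric.sphere_subset_closedBall).circleIntegrable ht0.le), h2,
    circleIntegral.integral_const_mul, circleIntegral.integral_sub_center_inv z ht0.ne']
  have := Complex.two_pi_I_ne_zero
  field_simp
  simp

end SimplePoleAt

/-- `F` is meromorphic on `U` with at most simple poles, the poles and the residues being algebraic
numbers. -/
def AlgPolesOn (F : ℂ → ℂ) (U : Set ℂ) : Prop :=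
  ∀ z ∈ U, ∃ r ∈ Qbar, (r ≠ 0 → z ∈ Qbar) ∧ SimplePoleAt F z r

namespace AlgPolesOn

variable {F G : ℂ → ℂ} {U : Set ℂ}

theorem of_differentiableOn (hU : IsOpen U) (h : DifferentiableOn ℂ F U) : AlgPolesOn F U :=
  fun _ hz => ⟨0, zero_mem _, fun h => absurd rfl h,
    (h.analyticAt (hU.mem_nhds hz)).simplePoleAt⟩

theorem add (hF : AlgPolesOn F U) (hG : AlgPolesOn G U) : AlgPolesOn (fun s => F s + G s) U := by
  intro z hz
  obtain ⟨r, hr, hrz, h⟩ := hF z hz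
  obtain ⟨r', hr', hrz', h'⟩ := hG z hz
  refine ⟨r + r', add_mem hr hr', fun hne => ?_, h.add h'⟩
  by_cases h0 : r = 0
  · exact hrz' fun h0' => hne (by simp [h0, h0'])
  · exact hrz h0

theorem mul {p : ℂ → ℂ} (hp : ∀ z ∈ U, AnalyticAt ℂ p z) (hpQ : ∀ z : ℂ, z ∈ Qbar → p z ∈ Qbar)
    (hF : AlgPolesOn F U) : AlgPolesOn (fun s => p s * F s) U := by
  intro z hz
  obtain ⟨r, hr, hrz, h⟩ := hF z hz
  by_cases h0 : r = 0
  · exact ⟨0, zero_mem _, fun h => absurd rfl h, by simpa [h0] using h.analytic_mul (hp z hz)⟩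
  · exact ⟨p z * r, mul_mem (hpQ z (hrz h0)) hr, fun _ => hrz h0, h.analytic_mul (hp z hz)⟩

theorem meromorphicOn (hF : AlgPolesOn F U) : MeromorphicOn F U := fun z hz => by
  obtain ⟨r, -, -, h⟩ := hF z hz
  exact h.meromorphicAt

theorem comp_add {c : ℂ} (hF : AlgPolesOn F U) (hc : c ∈ Qbar) :
    AlgPolesOn (fun s => F (s + c)) ((· + c) ⁻¹' U) := by
  intro z hz
  obtain ⟨r, hr, hrz, h⟩ := hF _ hz
  refine ⟨r, hr, fun h0 => ?_, h.comp_add⟩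
  simpa using sub_mem (hrz h0) hc

end AlgPolesOn

/-! ### Meromorphic continuation from half-planes -/

theorem isOpen_re_gt (c : ℝ) : IsOpen {s : ℂ | c < s.re} :=
  isOpen_lt continuous_const Complex.continuous_re

theorem isPreconnected_re_gt (c : ℝ) : IsPreconnected {s : ℂ | c < s.re} :=
  (convex_halfSpace_re_gt c).isPreconnected

/-- The identity theorem for meromorphic functions on a half-plane that agree further right. -/
theorem eventuallyEq_of_re_gt {F G : ℂ → ℂ} {c σ : ℝ} (hF : MeromorphicOn F {s | c < s.re})
    (hG : MeromorphicOn G {s | c < s.re}) (h : ∀ s : ℂ, σ < s.re → F s = G s) {z : ℂ}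
    (hz : c < z.re) : F =ᶠ[𝓝[≠] z] G := by
  have key : meromorphicOrderAt (F - G) z = ⊤ := by
    by_contra hne
    have hw : c < ((max c σ + 1 : ℝ) : ℂ).re := by
      rw [Complex.ofReal_re]; linarith [le_max_left c σ]
    have := MeromorphicOn.meromorphicOrderAt_ne_top_of_isPreconnected (hF.sub hG)
      (isPreconnected_re_gt c) hz hw hne
    refine this (meromorphicOrderAt_eq_top_iff.2 (Eventually.filter_mono nhdsWithin_le_nhds ?_))
    have : {s : ℂ | σ < s.re} ∈ 𝓝 ((max c σ + 1 : ℝ) : ℂ) := by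
      refine (isOpen_re_gt σ).mem_nhds ?_
      rw [Set.mem_ofPred_eq, Complex.ofReal_re]; linarith [le_max_right c σ]
    filter_upwards [this] with s hs
    simp [h s hs]
  rw [meromorphicOrderAt_eq_top_iff] at key
  filter_upwards [key] with s hs
  simpa [sub_eq_zero] using hs

theorem eventuallyEq_of_meromorphic {F G : ℂ → ℂ} {σ : ℝ} (hF : Meromorphic F)
    (hG : Meromorphic G) (h : ∀ s : ℂ, σ < s.re → F s = G s) (z : ℂ) : F =ᶠ[𝓝[≠] z] G :=
  eventuallyEq_of_re_gt (c := z.re - 1) (fun x _ => hF x) (fun x _ => hG x) h (by simp)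

/-- Continuations to an exhausting sequence of half-planes glue to a continuation to `ℂ`. -/
theorem exists_glue (I : ℂ → ℂ) (c : ℝ) (G : ℕ → ℂ → ℂ)
    (hG : ∀ k : ℕ, MeromorphicOn (G k) {s | c - k < s.re})
    (hI : ∀ k, ∃ σ : ℝ, ∀ s : ℂ, σ < s.re → I s = G k s) :
    ∃ H : ℂ → ℂ, (∃ σ : ℝ, ∀ s : ℂ, σ < s.re → I s = H s) ∧
      ∀ (z : ℂ) (k : ℕ), c - k < z.re → H =ᶠ[𝓝[≠] z] G k := by
  have hcomp : ∀ (z : ℂ) (k l : ℕ), k ≤ l → c - k < z.re → G k =ᶠ[𝓝[≠] z] G l := by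
    intro z k l hkl hz
    obtain ⟨σ, hσ⟩ := hI k
    obtain ⟨σ', hσ'⟩ := hI l
    have hkl' : (k : ℝ) ≤ l := by exact_mod_cast hkl
    refine eventuallyEq_of_re_gt (σ := max σ σ') (hG k)
      ((hG l).mono_set fun s hs => ?_) (fun s hs => ?_) hz
    · rw [Set.mem_ofPred_eq] at hs ⊢; linarith
    · rw [← hσ s ((le_max_left _ _).trans_lt hs), hσ' s ((le_max_right _ _).trans_lt hs)]
  have hcomp' : ∀ (z : ℂ) (k l : ℕ), c - k < z.re → c - l < z.re → G k =ᶠ[𝓝[≠] z] G l := by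
    intro z k l hk hl
    rcases le_total k l with h | h
    · exact hcomp z k l h hk
    · exact (hcomp z l k h hl).symm
  refine ⟨fun s => G (⌈c - s.re⌉₊ + 1) s, ?_, ?_⟩
  · obtain ⟨σ, hσ⟩ := hI 1
    refine ⟨max c σ, fun s hs => ?_⟩
    have : ⌈c - s.re⌉₊ = 0 := by
      rw [Nat.ceil_eq_zero]; linarith [(le_max_left c σ).trans_lt hs]
    simp only [hσ s ((le_max_right _ _).trans_lt hs), this, zero_add]
  · intro z k hk
    set K := ⌈c - z.re⌉₊ + 2 with hK
    have h1 : ∀ᶠ s in 𝓝[≠] z, ∀ l ∈ Finset.range (K + 1), c - l < z.re → G l s = G k s := by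
      rw [Filter.eventually_all_finset]
      intro l _
      by_cases hl : c - l < z.re
      · filter_upwards [hcomp' z l k hl hk] with s hs _ using hs
      · exact Eventually.of_forall fun s h => absurd h hl
    have h2 : ∀ᶠ s in 𝓝[≠] z, |s.re - z.re| < 1 := by
      refine Eventually.filter_mono nhdsWithin_le_nhds ?_
      have : ContinuousAt (fun s : ℂ => |s.re - z.re|) z := by fun_prop
      exact this.eventually_lt_const (by simp)
    filter_upwards [h1, h2] with s hs hsz
    rw [abs_lt] at hsz
    have h3 := Nat.le_ceil (c - s.re)
    have h4 := Nat.le_ceil (c - z.re)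
    refine hs _ ?_ ?_
    · rw [Finset.mem_range, hK]
      have : ⌈c - s.re⌉₊ ≤ ⌈c - z.re⌉₊ + 1 := by
        rw [Nat.ceil_le]; push_cast; linarith
      omega
    · push_cast; linarith

/-! ### Functions negligible up to algebraic data -/

/-- `I` agrees far to the right with a meromorphic function on `ℂ` that has at most simple poles,
with algebraic poles and residues. -/
def HasAlgCont (I : ℂ → ℂ) : Prop :=
  ∃ G : ℂ → ℂ, AlgPolesOn G Set.univ ∧ ∃ σ : ℝ, ∀ s : ℂ, σ < s.re → I s = G s

namespace HasAlgCont

variable {I J : ℂ → ℂ}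

theorem congr (hI : HasAlgCont I) {σ : ℝ} (h : ∀ s : ℂ, σ < s.re → J s = I s) : HasAlgCont J := by
  obtain ⟨G, hG, σ', h'⟩ := hI
  exact ⟨G, hG, max σ σ', fun s hs => by
    rw [h s ((le_max_left _ _).trans_lt hs), h' s ((le_max_right _ _).trans_lt hs)]⟩

theorem zero : HasAlgCont fun _ => 0 :=
  ⟨fun _ => 0, .of_differentiableOn isOpen_univ (differentiableOn_const _), 0, fun _ _ => rfl⟩

theorem add (hI : HasAlgCont I) (hJ : HasAlgCont J) : HasAlgCont fun s => I s + J s := by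
  obtain ⟨G, hG, σ, h⟩ := hI
  obtain ⟨G', hG', σ', h'⟩ := hJ
  exact ⟨_, hG.add hG', max σ σ', fun s hs => by
    simp only [h s ((le_max_left _ _).trans_lt hs), h' s ((le_max_right _ _).trans_lt hs)]⟩

theorem mul {p : ℂ → ℂ} (hp : Differentiable ℂ p) (hpQ : ∀ z ∈ Qbar, p z ∈ Qbar)
    (hI : HasAlgCont I) : HasAlgCont fun s => p s * I s := by
  obtain ⟨G, hG, σ, h⟩ := hI
  exact ⟨_, hG.mul (fun z _ => hp.analyticAt z) hpQ, σ, fun s hs => by simp only [h s hs]⟩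

theorem neg (hI : HasAlgCont I) : HasAlgCont fun s => - I s := by
  simpa using hI.mul (p := fun _ => -1) (by fun_prop) fun _ _ => neg_mem (one_mem _)

theorem sub (hI : HasAlgCont I) (hJ : HasAlgCont J) : HasAlgCont fun s => I s - J s := by
  simpa [sub_eq_add_neg] using hI.add hJ.neg

theorem sum {ι : Type*} (t : Finset ι) {I : ι → ℂ → ℂ} (h : ∀ i ∈ t, HasAlgCont (I i)) :
    HasAlgCont fun s => ∑ i ∈ t, I i s := by
  classical
  induction t using Finset.induction_on with
  | empty => simpa using zero
  | insert a t ha ih =>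
    simp only [Finset.sum_insert ha]
    exact (h a (by simp)).add (ih fun i hi => h i (by simp [hi]))

theorem comp_add (hI : HasAlgCont I) (c : ℚ) : HasAlgCont fun s => I (s + (c : ℂ)) := by
  obtain ⟨G, hG, σ, h⟩ := hI
  refine ⟨_, hG.comp_add (c := (c : ℂ)) ?_, σ - c, fun s hs => ?_⟩
  · exact_mod_cast Qbar.algebraMap_mem c
  · refine h _ ?_
    rw [Complex.add_re, Complex.ratCast_re]
    linarith

end HasAlgCont

/-! ### Holomorphy of integrals of complex powers -/

theorem rpow_le_rpow_add_rpow {x A B e : ℝ} (hx : 0 < x) (hA : A ≤ e) (hB : e ≤ B) :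
    x ^ e ≤ x ^ A + x ^ B := by
  have h1 := Real.rpow_pos_of_pos hx A
  have h2 := Real.rpow_pos_of_pos hx B
  rcases le_total x 1 with h | h
  · linarith [Real.rpow_le_rpow_of_exponent_ge hx h hA]
  · linarith [Real.rpow_le_rpow_of_exponent_le h hB]

theorem abs_log_le_rpow_add_rpow {x ε : ℝ} (hx : 0 < x) (hε : 0 < ε) :
    |Real.log x| ≤ (x ^ ε + x ^ (-ε)) / ε := by
  have h1 := Real.log_le_rpow_div hx.le hε
  have h2 := Real.log_le_rpow_div (inv_pos.2 hx).le hε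
  rw [Real.log_inv, Real.inv_rpow hx.le, ← Real.rpow_neg hx.le] at h2
  have h3 : 0 < x ^ ε / ε := div_pos (Real.rpow_pos_of_pos hx _) hε
  have h4 : 0 < x ^ (-ε) / ε := div_pos (Real.rpow_pos_of_pos hx _) hε
  rw [add_div, abs_le]
  constructor <;> linarith

/-- On the set of `s` whose real part lies in an open set of exponents of absolute convergence, the
integral of `p ^ s` against a weight is holomorphic. The derivative `p ^ s log p` is dominated by
the powers of `p` at two nearby exponents of convergence. -/
theorem differentiableOn_integral_cpow {X : Type*} [MeasurableSpace X] {μ : Measure X}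
    {p : X → ℝ} {W : X → ℂ} (hp : Measurable p) (hW : AEStronglyMeasurable W μ)
    (hpos : ∀ᵐ x ∂μ, 0 < p x) {S : Set ℝ} (hS : IsOpen S)
    (hint : ∀ σ ∈ S, Integrable (fun x => ((p x : ℂ) ^ (σ : ℂ)) * W x) μ) :
    DifferentiableOn ℂ (fun s : ℂ => ∫ x, (p x : ℂ) ^ s * W x ∂μ) {s | s.re ∈ S} := by
  intro s₀ hs₀
  obtain ⟨δ, hδ, hball⟩ := Metric.isOpen_iff.1 hS _ hs₀
  set ε := δ / 3 with hε
  have hε0 : 0 < ε := by positivity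
  set A := s₀.re - 2 * ε
  set B := s₀.re + 2 * ε
  have hA : A ∈ S := hball (by
    rw [Metric.mem_ball, Real.dist_eq, abs_lt]; constructor <;> simp only [A] <;> linarith)
  have hB : B ∈ S := hball (by
    rw [Metric.mem_ball, Real.dist_eq, abs_lt]; constructor <;> simp only [B] <;> linarith)
  have hpC : Measurable fun x => (p x : ℂ) := Complex.measurable_ofReal.comp hp
  have hmeas : ∀ s : ℂ, AEStronglyMeasurable (fun x => (p x : ℂ) ^ s * W x) μ := fun s =>
    (hpC.pow_const s).aestronglyMeasurable.mul hW
  have hnorm : ∀ σ : ℝ, ∀ x, 0 < p x →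
      ‖(p x : ℂ) ^ (σ : ℂ) * W x‖ = p x ^ σ * ‖W x‖ := fun σ x hx => by
    rw [norm_mul, Complex.norm_cpow_eq_rpow_re_of_pos hx, Complex.ofReal_re]
  have hint0 : Integrable (fun x => (p x : ℂ) ^ s₀ * W x) μ := by
    refine (hint _ hs₀).mono (hmeas _) ?_
    filter_upwards [hpos] with x hx
    rw [hnorm _ x hx, norm_mul, Complex.norm_cpow_eq_rpow_re_of_pos hx]
  have key := hasDerivAt_integral_of_dominated_loc_of_deriv_le (μ := μ) (𝕜 := ℂ) (x₀ := s₀)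
    (F := fun s x => (p x : ℂ) ^ s * W x)
    (F' := fun s x => (p x : ℂ) ^ s * Complex.log (p x) * W x)
    (bound := fun x => 2 / ε *
      (‖(p x : ℂ) ^ (A : ℂ) * W x‖ + ‖(p x : ℂ) ^ (B : ℂ) * W x‖))
    (Metric.ball_mem_nhds s₀ hε0) (Eventually.of_forall hmeas) hint0 ?_ ?_ ?_ ?_
  · exact key.2.differentiableAt.differentiableWithinAt
  · exact ((hpC.pow_const s₀).mul (Complex.measurable_log.comp hpC)).aestronglyMeasurable.mul hW
  · filter_upwards [hpos] with x hx s hs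
    have hre : |s.re - s₀.re| < ε := by
      rw [← Complex.sub_re]
      exact (Complex.abs_re_le_norm _).trans_lt (by simpa [dist_eq_norm] using hs)
    rw [abs_lt] at hre
    rw [hnorm _ x hx, hnorm _ x hx, norm_mul, norm_mul,
      Complex.norm_cpow_eq_rpow_re_of_pos hx, ← Complex.ofReal_log hx.le, Complex.norm_real,
      Real.norm_eq_abs, ← add_mul, ← mul_assoc]
    refine mul_le_mul_of_nonneg_right ?_ (norm_nonneg _)
    have h1 : p x ^ (s.re + ε) ≤ p x ^ A + p x ^ B :=
      rpow_le_rpow_add_rpow hx (by simp only [A]; linarith) (by simp only [B]; linarith)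
    have h2 : p x ^ (s.re - ε) ≤ p x ^ A + p x ^ B :=
      rpow_le_rpow_add_rpow hx (by simp only [A]; linarith) (by simp only [B]; linarith)
    calc p x ^ s.re * |Real.log (p x)| ≤ p x ^ s.re * ((p x ^ ε + p x ^ (-ε)) / ε) :=
          mul_le_mul_of_nonneg_left (abs_log_le_rpow_add_rpow hx hε0) (Real.rpow_nonneg hx.le _)
      _ = (p x ^ (s.re + ε) + p x ^ (s.re - ε)) / ε := by
          rw [Real.rpow_add hx, sub_eq_add_neg, Real.rpow_add hx]; ring
      _ ≤ ((p x ^ A + p x ^ B) + (p x ^ A + p x ^ B)) / ε := by gcongr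
      _ = 2 / ε * (p x ^ A + p x ^ B) := by ring
  · exact ((hint A hA).norm.add (hint B hB).norm).const_mul _
  · filter_upwards [hpos] with x hx s _
    have hx' : (p x : ℂ) ≠ 0 := by exact_mod_cast hx.ne'
    exact ((Complex.hasStrictDerivAt_const_cpow (Or.inl hx')).hasDerivAt).mul_const _

/-! ### Integrals of powers of one polynomial in one variable -/

/-- The complex polynomials in one variable with algebraic coefficients. -/
noncomputable abbrev algPoly : Subring ℂ[X] := (Polynomial.mapRingHom (algebraMap Qbar ℂ)).range

theorem mem_algPoly_iff {P : ℂ[X]} : P ∈ algPoly ↔ ∀ n, P.coeff n ∈ Qbar := by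
  constructor
  · rintro ⟨Q, rfl⟩ n
    simp
  · intro h
    refine (Polynomial.mem_map_range _).2 fun n => ⟨⟨_, h n⟩, rfl⟩

theorem C_mem_algPoly {c : ℂ} (hc : c ∈ Qbar) : Polynomial.C c ∈ algPoly :=
  ⟨Polynomial.C ⟨c, hc⟩, by simp⟩

theorem X_mem_algPoly : (Polynomial.X : ℂ[X]) ∈ algPoly := ⟨Polynomial.X, by simp⟩

theorem derivative_mem_algPoly {P : ℂ[X]} (h : P ∈ algPoly) : derivative P ∈ algPoly := by
  obtain ⟨Q, rfl⟩ := h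
  exact ⟨derivative Q, by simp [derivative_map]⟩

theorem eval_mem_Qbar {P : ℂ[X]} (h : P ∈ algPoly) {c : ℂ} (hc : c ∈ Qbar) :
    P.eval c ∈ Qbar := by
  rw [mem_algPoly_iff] at h
  rw [Polynomial.eval_eq_sum_range]
  exact sum_mem fun i _ => mul_mem (h i) (pow_mem hc i)

theorem cpow_ratCast_mem_Qbar {c : ℂ} (hc : c ∈ Qbar) (q : ℚ) : c ^ (q : ℂ) ∈ Qbar := by
  rw [mem_algebraicClosure_iff]
  refine IsAlgebraic.of_pow (n := q.den) q.den_pos ?_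
  rw [← Complex.cpow_mul_nat]
  have : (q : ℂ) * (q.den : ℂ) = (q.num : ℂ) := by exact_mod_cast Rat.mul_den_eq_num q
  rw [this, Complex.cpow_intCast, ← mem_algebraicClosure_iff]
  exact zpow_mem hc _

section MonomialTimesUnit

variable (k : ℕ) (p : ℝ[X])

/-- The integral `∫₀¹ t ^ (k s + j) p(t) ^ (s - a) Q(t) dt`. -/
noncomputable def edgeIntegral (Q : ℂ[X]) (a j : ℕ) (s : ℂ) : ℂ :=
  ∫ t in (0 : ℝ)..1, (t : ℂ) ^ (k * s + j) * (((p.eval t : ℝ) : ℂ) ^ (s - a) * Q.eval (t : ℂ))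

variable {k p}

theorem continuousOn_cpow_mul_eval (hp : ∀ t ∈ Set.Icc (0 : ℝ) 1, 0 < p.eval t) (Q : ℂ[X]) (b : ℂ) :
    ContinuousOn (fun t : ℝ => ((p.eval t : ℝ) : ℂ) ^ b * Q.eval (t : ℂ)) (Set.Icc 0 1) := by
  refine ContinuousOn.mul (ContinuousOn.cpow_const (by fun_prop) fun t ht => ?_) (by fun_prop)
  exact Complex.ofReal_mem_slitPlane.2 (hp t ht)

theorem intervalIntegrable_edge (hp : ∀ t ∈ Set.Icc (0 : ℝ) 1, 0 < p.eval t) (Q : ℂ[X]) (b : ℂ)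
    {w : ℂ} (hw : -1 < w.re) :
    IntervalIntegrable (fun t : ℝ => (t : ℂ) ^ w * (((p.eval t : ℝ) : ℂ) ^ b * Q.eval (t : ℂ)))
      volume 0 1 := by
  refine (intervalIntegral.intervalIntegrable_cpow' hw).mul_continuousOn ?_
  rw [Set.uIcc_of_le zero_le_one]
  exact continuousOn_cpow_mul_eval hp Q b

theorem differentiableOn_edgeIntegral (hp : ∀ t ∈ Set.Icc (0 : ℝ) 1, 0 < p.eval t) (Q : ℂ[X])
    (a j : ℕ) :
    DifferentiableOn ℂ (edgeIntegral k p Q a j) {s | -1 < k * s.re + j} := by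
  have hrew : ∀ s : ℂ, ∀ t ∈ Set.Ioc (0 : ℝ) 1,
      (t : ℂ) ^ (k * s + j) * (((p.eval t : ℝ) : ℂ) ^ (s - a) * Q.eval (t : ℂ)) =
      ((t ^ k * p.eval t : ℝ) : ℂ) ^ s *
        ((t : ℂ) ^ j * (((p.eval t : ℝ) : ℂ) ^ (-(a : ℂ)) * Q.eval (t : ℂ))) := by
    intro s t ht
    have ht0 : (t : ℂ) ≠ 0 := by exact_mod_cast ht.1.ne'
    have hpt := hp t ⟨ht.1.le, ht.2⟩
    have hp0 : ((p.eval t : ℝ) : ℂ) ≠ 0 := by exact_mod_cast hpt.ne'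
    rw [Complex.ofReal_mul, Complex.mul_cpow_ofReal_nonneg (pow_nonneg ht.1.le k) hpt.le,
      Complex.cpow_add _ _ ht0, sub_eq_add_neg, Complex.cpow_add _ _ hp0, Complex.cpow_natCast,
      Complex.cpow_nat_mul' (x := (t : ℂ))]
    · push_cast
      ring
    · rw [Complex.arg_ofReal_of_nonneg ht.1.le]; simpa using Real.pi_pos
    · rw [Complex.arg_ofReal_of_nonneg ht.1.le]; simpa using Real.pi_pos.le
  have h := differentiableOn_integral_cpow (μ := volume.restrict (Set.Ioc (0 : ℝ) 1))
    (p := fun t => t ^ k * p.eval t)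
    (W := fun t => (t : ℂ) ^ j * (((p.eval t : ℝ) : ℂ) ^ (-(a : ℂ)) * Q.eval (t : ℂ)))
    (S := {σ | -1 < k * σ + j}) (by fun_prop) ?_ ?_
    (isOpen_lt (by fun_prop) (by fun_prop)) ?_
  · refine h.congr fun s _ => ?_
    rw [edgeIntegral, intervalIntegral.integral_of_le zero_le_one]
    exact setIntegral_congr_fun measurableSet_Ioc fun t ht => hrew s t ht
  · refine (ContinuousOn.mul (by fun_prop) (continuousOn_cpow_mul_eval hp Q _)).mono
      Set.Ioc_subset_Icc_self |>.aestronglyMeasurable measurableSet_Ioc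
  · filter_upwards [ae_restrict_mem measurableSet_Ioc] with t ht
    exact mul_pos (pow_pos ht.1 k) (hp t ⟨ht.1.le, ht.2⟩)
  · intro σ hσ
    have := intervalIntegrable_edge hp Q (σ - a) (w := k * σ + j) (by simpa using hσ)
    rw [intervalIntegrable_iff_integrableOn_Ioc_of_le zero_le_one] at this
    refine this.congr ?_
    filter_upwards [ae_restrict_mem measurableSet_Ioc] with t ht using hrew σ t ht

theorem hasDerivAt_cpow_mul_eval {t : ℝ} (hp : 0 < p.eval t) (Q : ℂ[X]) (b : ℂ) :
    HasDerivAt (fun t : ℝ => ((p.eval t : ℝ) : ℂ) ^ b * Q.eval (t : ℂ))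
      (((p.eval t : ℝ) : ℂ) ^ b * (derivative Q).eval (t : ℂ) + b * (((p.eval t : ℝ) : ℂ) ^ (b - 1) *
        ((derivative p).map (algebraMap ℝ ℂ) * Q).eval (t : ℂ))) t := by
  have h1 : HasDerivAt (fun t : ℝ => ((p.eval t : ℝ) : ℂ)) (((derivative p).eval t : ℝ) : ℂ) t :=
    (p.hasDerivAt t).ofReal_comp
  have h2 : HasDerivAt (fun t : ℝ => Q.eval (t : ℂ)) ((derivative Q).eval (t : ℂ)) t :=
    (Q.hasDerivAt (t : ℂ)).comp_ofReal
  have h3 : HasDerivAt (fun t : ℝ => ((p.eval t : ℝ) : ℂ) ^ b)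
      (b * ((p.eval t : ℝ) : ℂ) ^ (b - 1) * (((derivative p).eval t : ℝ) : ℂ)) t := by
    have := (hasStrictDerivAt_id _).hasDerivAt (x := ((p.eval t : ℝ) : ℂ))
    have h4 : HasDerivAt (fun z : ℂ => z ^ b) (b * ((p.eval t : ℝ) : ℂ) ^ (b - 1)) ((p.eval t : ℝ) : ℂ) := by
      simpa using this.cpow_const (c := b) (Complex.ofReal_mem_slitPlane.2 hp)
    exact h4.comp t h1
  refine (h3.mul h2).congr_deriv ?_
  have : ((derivative p).map (algebraMap ℝ ℂ)).eval (t : ℂ) = (((derivative p).eval t : ℝ) : ℂ) := by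
    exact Polynomial.eval_map_apply (Complex.ofRealHom) t
  rw [Polynomial.eval_mul, this]
  ring

/-- Integration by parts, in the half-plane where the boundary term at `0` vanishes. -/
theorem edgeIntegral_step (hp : ∀ t ∈ Set.Icc (0 : ℝ) 1, 0 < p.eval t) (Q : ℂ[X]) (a j : ℕ)
    {s : ℂ} (hs : -1 < k * s.re + j) :
    (k * s + (j + 1)) * edgeIntegral k p Q a j s =
      ((p.eval 1 : ℝ) : ℂ) ^ (s - a) * Q.eval 1 - edgeIntegral k p (derivative Q) a (j + 1) s -
        (s - a) *
          edgeIntegral k p ((derivative p).map (algebraMap ℝ ℂ) * Q) (a + 1) (j + 1) s := by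
  set w : ℂ := k * s + j with hw
  have hw1 : -1 < w.re := by simpa [hw] using hs
  have hw2 : 0 < (w + 1).re := by rw [Complex.add_re, Complex.one_re]; linarith
  have hw0 : w + 1 ≠ 0 := fun h => by simp [h] at hw2
  set h : ℝ → ℂ := fun t => ((p.eval t : ℝ) : ℂ) ^ (s - a) * Q.eval (t : ℂ) with hh
  have i1 := intervalIntegrable_edge hp Q (s - a) hw1
  have i2 := intervalIntegrable_edge hp (derivative Q) (s - a) (w := w + 1) (by linarith)
  have i3 := intervalIntegrable_edge hp ((derivative p).map (algebraMap ℝ ℂ) * Q) (s - a - 1)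
    (w := w + 1) (by linarith)
  have key := intervalIntegral.integral_eq_sub_of_hasDerivAt_of_le (a := 0) (b := 1)
    (f := fun t : ℝ => (t : ℂ) ^ (w + 1) * h t) zero_le_one
    ((Complex.continuous_ofReal_cpow_const hw2).continuousOn.mul
      (continuousOn_cpow_mul_eval hp Q _))
    (fun t ht => by
      have h1 : HasDerivAt (fun t : ℝ => (t : ℂ) ^ (w + 1)) ((w + 1) * (t : ℂ) ^ w) t := by
        have := hasDerivAt_ofReal_cpow_const (x := t) ht.1.ne' (r := w + 1) hw0
        simpa using this
      exact h1.mul (hasDerivAt_cpow_mul_eval (hp t ⟨ht.1.le, ht.2.le⟩) Q (s - a))) ?_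
  · have e : (fun t : ℝ => (w + 1) * (t : ℂ) ^ w * h t + (t : ℂ) ^ (w + 1) *
        (((p.eval t : ℝ) : ℂ) ^ (s - a) * (derivative Q).eval (t : ℂ) +
          (s - a) * (((p.eval t : ℝ) : ℂ) ^ (s - a - 1) *
            ((derivative p).map (algebraMap ℝ ℂ) * Q).eval (t : ℂ)))) =
        fun t : ℝ => ((w + 1) * ((t : ℂ) ^ w * h t) + (t : ℂ) ^ (w + 1) *
          (((p.eval t : ℝ) : ℂ) ^ (s - a) * (derivative Q).eval (t : ℂ))) +
          (s - a) * ((t : ℂ) ^ (w + 1) * (((p.eval t : ℝ) : ℂ) ^ (s - a - 1) *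
            ((derivative p).map (algebraMap ℝ ℂ) * Q).eval (t : ℂ))) := by
      ext t; ring
    rw [e, intervalIntegral.integral_add ((i1.const_mul _).add i2) (i3.const_mul _),
      intervalIntegral.integral_add (i1.const_mul _) i2, intervalIntegral.integral_const_mul,
      intervalIntegral.integral_const_mul] at key
    have e2 : (k * s + (j + 1) : ℂ) = w + 1 := by rw [hw]; ring
    have e3 : (k * s + ((j + 1 : ℕ) : ℂ) : ℂ) = w + 1 := by rw [hw]; push_cast; ring
    have e4 : s - ((a + 1 : ℕ) : ℂ) = s - a - 1 := by push_cast; ring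
    simp only [edgeIntegral, e2, e3, e4, ← hw]
    simp only [hh, Complex.ofReal_zero, Complex.zero_cpow hw0, zero_mul, sub_zero,
      Complex.ofReal_one, Complex.one_cpow, one_mul] at key
    linear_combination key
  · have := ((i1.const_mul (w + 1)).add i2).add (i3.const_mul (s - a))
    refine this.congr ?_
    intro t _
    simp only [hh]
    ring

/-- At a point where the power of `t` in the integrated terms is `t ^ 0`, they add up to the
increment of `p ^ (s - a) Q`. -/
theorem edgeIntegral_at_pole (hp : ∀ t ∈ Set.Icc (0 : ℝ) 1, 0 < p.eval t) (Q : ℂ[X]) (a j : ℕ)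
    {s : ℂ} (hs : k * s + (j + 1) = 0) :
    ((p.eval 1 : ℝ) : ℂ) ^ (s - a) * Q.eval 1 - edgeIntegral k p (derivative Q) a (j + 1) s -
        (s - a) *
          edgeIntegral k p ((derivative p).map (algebraMap ℝ ℂ) * Q) (a + 1) (j + 1) s =
      ((p.eval 0 : ℝ) : ℂ) ^ (s - a) * Q.eval 0 := by
  have i2 := intervalIntegrable_edge hp (derivative Q) (s - a) (w := 0) (by simp)
  have i3 := intervalIntegrable_edge hp ((derivative p).map (algebraMap ℝ ℂ) * Q) (s - a - 1)
    (w := 0) (by simp)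
  simp only [Complex.cpow_zero, one_mul] at i2 i3
  have key := intervalIntegral.integral_eq_sub_of_hasDerivAt_of_le (a := 0) (b := 1) zero_le_one
    (continuousOn_cpow_mul_eval hp Q (s - a))
    (fun t ht => hasDerivAt_cpow_mul_eval (hp t ⟨ht.1.le, ht.2.le⟩) Q (s - a))
    (i2.add (i3.const_mul _))
  rw [intervalIntegral.integral_add i2 (i3.const_mul _),
    intervalIntegral.integral_const_mul] at key
  have e3 : (k * s + ((j + 1 : ℕ) : ℂ) : ℂ) = 0 := by rw [← hs]; push_cast; ring
  have e4 : s - ((a + 1 : ℕ) : ℂ) = s - a - 1 := by push_cast; ring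
  simp only [edgeIntegral, e3, e4, Complex.cpow_zero, one_mul]
  simp only [Complex.ofReal_zero, Complex.ofReal_one] at key
  linear_combination -key

/-- Each integration by parts continues `edgeIntegral` to a larger half-plane. The poles are the
zeros of `k s + j + 1` met on the way, and the residue at such a zero `z` is
`p(0) ^ (z - a) Q(0) / k`, an algebraic number because `z` is rational. -/
theorem exists_continuation_edgeIntegral (hk : 0 < k)
    (hp : ∀ t ∈ Set.Icc (0 : ℝ) 1, 0 < p.eval t) (hpQ : p.map (algebraMap ℝ ℂ) ∈ algPoly) (N : ℕ) :
    ∀ (Q : ℂ[X]) (a j : ℕ), Q ∈ algPoly → ∃ G : ℂ → ℂ,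
      AlgPolesOn G {s | -1 - N < k * s.re + j} ∧
        ∀ s : ℂ, -1 < k * s.re + j → edgeIntegral k p Q a j s = G s := by
  have hkC : (k : ℂ) ≠ 0 := by exact_mod_cast hk.ne'
  have hopen : ∀ c : ℝ, ∀ j : ℕ, IsOpen {s : ℂ | c < k * s.re + j} := fun c j =>
    isOpen_lt (by fun_prop) (by fun_prop)
  have hev : ∀ c : ℝ, (p.map (algebraMap ℝ ℂ)).eval (c : ℂ) = ((p.eval c : ℝ) : ℂ) := fun c =>
    Polynomial.eval_map_apply (Complex.ofRealHom) c
  induction N with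
  | zero =>
    intro Q a j _
    refine ⟨edgeIntegral k p Q a j, ?_, fun s _ => rfl⟩
    have := AlgPolesOn.of_differentiableOn (hopen (-1) j)
      (differentiableOn_edgeIntegral (k := k) hp Q a j)
    simpa using this
  | succ N ih =>
    intro Q a j hQ
    obtain ⟨G₁, hG₁, e₁⟩ := ih _ a (j + 1) (derivative_mem_algPoly hQ)
    have hQ' : (derivative p).map (algebraMap ℝ ℂ) * Q ∈ algPoly := by
      rw [← derivative_map]
      exact mul_mem (derivative_mem_algPoly hpQ) hQ
    obtain ⟨G₂, hG₂, e₂⟩ := ih _ (a + 1) (j + 1) hQ'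
    have hp1 : ((p.eval 1 : ℝ) : ℂ) ≠ 0 := by exact_mod_cast (hp 1 (by simp)).ne'
    set U : Set ℂ := {s | -1 - ((N + 1 : ℕ) : ℝ) < k * s.re + j} with hU
    have hU' : U = {s : ℂ | -1 - (N : ℝ) < k * s.re + (j + 1 : ℕ)} := by
      ext s
      simp only [hU, Set.mem_ofPred_eq]
      push_cast
      constructor <;> intro h <;> linarith
    rw [← hU'] at hG₁ hG₂
    set num : ℂ → ℂ := fun s => ((p.eval 1 : ℝ) : ℂ) ^ (s - a) * Q.eval 1 + (-1) * G₁ s +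
      (-(s - a)) * G₂ s with hnum
    have hpow : Differentiable ℂ fun s : ℂ => ((p.eval 1 : ℝ) : ℂ) ^ (s - a) * Q.eval 1 :=
      fun s => (((differentiableAt_id.sub_const _).const_cpow (Or.inl hp1))).mul_const _
    have hnumA : AlgPolesOn num U := by
      refine AlgPolesOn.add (AlgPolesOn.add ?_ ?_) ?_
      · exact .of_differentiableOn (hopen _ _) hpow.differentiableOn
      · exact hG₁.mul (fun _ _ => analyticAt_const) fun _ _ => neg_mem (one_mem _)
      · exact hG₂.mul (fun _ _ => by fun_prop) fun z hz =>
          neg_mem (sub_mem hz (natCast_mem _ a))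
    refine ⟨fun s => num s / (k * s + (j + 1)), fun z hz => ?_, fun s hs => ?_⟩
    · by_cases hz0 : (k * z + (j + 1) : ℂ) = 0
      · -- near the zero of the denominator the numerator is given by convergent integrals
        set J : ℂ → ℂ := fun s => ((p.eval 1 : ℝ) : ℂ) ^ (s - a) * Q.eval 1 -
          edgeIntegral k p (derivative Q) a (j + 1) s - (s - a) *
          edgeIntegral k p ((derivative p).map (algebraMap ℝ ℂ) * Q) (a + 1) (j + 1) s with hJ
        have hzre : (-1 : ℝ) < k * z.re + (j + 1 : ℕ) := by
          have := congrArg Complex.re hz0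
          simp at this
          push_cast
          linarith
        have hmem := (hopen (-1) (j + 1)).mem_nhds hzre
        have hJA : AnalyticAt ℂ J z :=
          (((hpow.analyticAt z).sub
            ((differentiableOn_edgeIntegral hp _ a (j + 1)).analyticAt hmem))).sub
            (((analyticAt_id).sub analyticAt_const).mul
            ((differentiableOn_edgeIntegral hp _ (a + 1) (j + 1)).analyticAt hmem))
        have hzq : z = ((-((j : ℚ) + 1) / k : ℚ) : ℂ) := by
          push_cast
          field_simp
          linear_combination hz0
        have hzQ : z ∈ Qbar := by
          rw [hzq]
          exact_mod_cast Qbar.algebraMap_mem (-((j : ℚ) + 1) / k)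
        refine ⟨J z / k, ?_, fun _ => hzQ,
          ((SimplePoleAt.div_linear hJA hkC hz0)).congr ?_⟩
        · rw [hJ]
          simp only
          rw [edgeIntegral_at_pole hp Q a j hz0]
          refine div_mem (mul_mem ?_ (eval_mem_Qbar hQ (zero_mem _))) (natCast_mem _ k)
          have : z - a = ((-((j : ℚ) + 1) / k - a : ℚ) : ℂ) := by
            rw [hzq]; push_cast; ring
          rw [this]
          refine cpow_ratCast_mem_Qbar ?_ _
          rw [← hev]
          exact eval_mem_Qbar hpQ (by simp)
        · filter_upwards [nhdsWithin_le_nhds hmem] with s hs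
          simp only [hJ, hnum, e₁ s hs, e₂ s hs]
          ring
      · obtain ⟨r, hr, hrz, hF⟩ := hnumA z hz
        have han : AnalyticAt ℂ (fun s : ℂ => (k * s + (j + 1) : ℂ)⁻¹) z :=
          AnalyticAt.inv (by fun_prop) hz0
        have := hF.analytic_mul han
        refine ⟨(k * z + (j + 1) : ℂ)⁻¹ * r, ?_, fun h => hrz (right_ne_zero_of_mul h),
          this.congr (Eventually.of_forall fun s => div_eq_inv_mul _ _)⟩
        by_cases h0 : r = 0
        · simp [h0]
        · exact mul_mem (inv_mem (add_mem (mul_mem (natCast_mem _ k) (hrz h0))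
            (add_mem (natCast_mem _ j) (one_mem _)))) hr
    · have hs' : (-1 : ℝ) < k * s.re + (j + 1 : ℕ) := by push_cast; linarith
      have hne : (k * s + (j + 1) : ℂ) ≠ 0 := fun h => by
        have := congrArg Complex.re h
        simp at this
        linarith
      have := edgeIntegral_step hp Q a j hs
      rw [e₁ s hs', e₂ s hs'] at this
      rw [eq_div_iff hne, mul_comm, this]
      ring

end MonomialTimesUnit

/-- The integral over `[0, 1]` of `p ^ s Q`, for polynomials with algebraic coefficients and `p`
positive on `(0, 1]`, has a continuation with simple poles, algebraic poles and residues. -/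
theorem hasAlgCont_integral_cpow {p : ℝ[X]} {Q : ℂ[X]} (hp : ∀ t ∈ Set.Ioc (0 : ℝ) 1, 0 < p.eval t)
    (hpQ : p.map (algebraMap ℝ ℂ) ∈ algPoly) (hQ : Q ∈ algPoly) :
    HasAlgCont fun s => ∫ t in (0 : ℝ)..1, ((p.eval t : ℝ) : ℂ) ^ s * Q.eval (t : ℂ) := by
  have hp0 : p ≠ 0 := by
    rintro rfl
    simpa using hp 1 (by simp)
  obtain ⟨p₁, hfac, hndvd⟩ := Polynomial.exists_eq_pow_rootMultiplicity_mul_and_not_dvd p hp0 0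
  set k := p.rootMultiplicity 0
  rw [C_0, sub_zero] at hfac hndvd
  have hev : ∀ t : ℝ, p.eval t = t ^ k * p₁.eval t := fun t => by
    conv_lhs => rw [hfac]
    simp
  have hp₁pos : ∀ t ∈ Set.Ioc (0 : ℝ) 1, 0 < p₁.eval t := fun t ht => by
    have := hp t ht
    rw [hev] at this
    exact (pos_iff_pos_of_mul_pos this).1 (pow_pos ht.1 k)
  have hp₁ : ∀ t ∈ Set.Icc (0 : ℝ) 1, 0 < p₁.eval t := by
    intro t ht
    rcases ht.1.eq_or_lt with rfl | h
    · refine lt_of_le_of_ne ?_ fun h => hndvd ?_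
      · refine ge_of_tendsto (f := fun t : ℝ => p₁.eval t) (x := 𝓝[>] 0)
          (p₁.continuous.tendsto 0 |>.mono_left nhdsWithin_le_nhds) ?_
        filter_upwards [Ioc_mem_nhdsGT zero_lt_one] with t ht using (hp₁pos t ht).le
      · rw [Polynomial.X_dvd_iff, Polynomial.coeff_zero_eq_eval_zero, ← h]
    · exact hp₁pos t ⟨h, ht.2⟩
  have hp₁Q : p₁.map (algebraMap ℝ ℂ) ∈ algPoly := by
    rw [mem_algPoly_iff] at hpQ ⊢
    intro n
    have := hpQ (n + k)
    rwa [hfac, Polynomial.coeff_map, Polynomial.coeff_X_pow_mul, ← Polynomial.coeff_map] at this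
  have hJ : ∀ s : ℂ, (∫ t in (0 : ℝ)..1, ((p.eval t : ℝ) : ℂ) ^ s * Q.eval (t : ℂ)) =
      edgeIntegral k p₁ Q 0 0 s := by
    intro s
    rw [edgeIntegral]
    refine intervalIntegral.integral_congr_ae (Eventually.of_forall fun t ht => ?_)
    rw [Set.uIoc_of_le zero_le_one] at ht
    rw [hev, Complex.ofReal_mul, Complex.mul_cpow_ofReal_nonneg (pow_nonneg ht.1.le k)
      (hp₁pos t ht).le, Complex.ofReal_pow, ← Complex.cpow_nat_mul' (x := (t : ℂ))
      (by rw [Complex.arg_ofReal_of_nonneg ht.1.le]; simpa using Real.pi_pos)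
      (by rw [Complex.arg_ofReal_of_nonneg ht.1.le]; simpa using Real.pi_pos.le) s]
    simp only [Nat.cast_zero, add_zero, sub_zero]
    ring
  refine HasAlgCont.congr (I := edgeIntegral k p₁ Q 0 0) ?_ (σ := 0) fun s _ => hJ s
  rcases Nat.eq_zero_or_pos k with hk | hk
  · have h := differentiableOn_edgeIntegral (k := k) hp₁ Q 0 0
    have hU : {s : ℂ | (-1 : ℝ) < k * s.re + (0 : ℕ)} = Set.univ := by
      ext s; simp [hk]
    rw [hU] at h
    exact ⟨_, .of_differentiableOn isOpen_univ h, 0, fun _ _ => rfl⟩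
  · choose G hGA hG using fun N : ℕ =>
      exists_continuation_edgeIntegral hk hp₁ hp₁Q (N * k) Q 0 0 hQ
    have hkR : (0 : ℝ) < k := by exact_mod_cast hk
    have hsub : ∀ (N : ℕ) (s : ℂ), 0 - (N : ℝ) < s.re →
        -1 - ((N * k : ℕ) : ℝ) < k * s.re + (0 : ℕ) := by
      intro N s hs
      push_cast
      nlinarith
    obtain ⟨H, ⟨σ, hσ⟩, hH⟩ := exists_glue (edgeIntegral k p₁ Q 0 0) 0 G
      (fun N => (hGA N).meromorphicOn.mono_set (hsub N))
      (fun N => ⟨0, fun s hs => hG N s (by push_cast; nlinarith)⟩)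
    refine ⟨H, fun z _ => ?_, σ, hσ⟩
    obtain ⟨N, hN⟩ := exists_nat_gt (-z.re)
    obtain ⟨r, hr, hrz, h⟩ := hGA N z (hsub N z (by linarith))
    exact ⟨r, hr, hrz, h.congr (hH z N (by linarith))⟩

/-! ### Polynomials in two variables with algebraic coefficients -/

/-- The polynomials in `ℂ[x, y]` with algebraic coefficients. -/
noncomputable abbrev algR : Subring R := (MvPolynomial.map (algebraMap Qbar ℂ)).range

/-- The polynomials over `A` with coefficients in a subring. -/
def coeffSubring {A : Type*} [CommRing A] (S : Subring A) : Subring A[X] where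
  carrier := {Q | ∀ k, Q.coeff k ∈ S}
  mul_mem' {P Q} hP hQ k := by
    rw [Polynomial.coeff_mul]
    exact sum_mem fun x _ => mul_mem (hP x.1) (hQ x.2)
  one_mem' k := by
    rw [Polynomial.coeff_one]
    split_ifs
    exacts [one_mem _, zero_mem _]
  add_mem' {P Q} hP hQ k := by
    rw [Polynomial.coeff_add]
    exact add_mem (hP k) (hQ k)
  zero_mem' k := by simp
  neg_mem' {P} hP k := by
    rw [Polynomial.coeff_neg]
    exact neg_mem (hP k)

theorem C_mem_coeffSubring {A : Type*} [CommRing A] {S : Subring A} {q : A} (h : q ∈ S) :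
    Polynomial.C q ∈ coeffSubring S := fun k => by
  rw [Polynomial.coeff_C]
  split_ifs
  exacts [h, zero_mem _]

theorem X_mem_coeffSubring {A : Type*} [CommRing A] {S : Subring A} :
    (Polynomial.X : A[X]) ∈ coeffSubring S := fun k => by
  rw [Polynomial.coeff_X]
  split_ifs
  exacts [one_mem _, zero_mem _]

/-- The polynomials in `ℂ[x, y][s]` with algebraic coefficients. -/
noncomputable abbrev algRX : Subring R[X] := coeffSubring algR

theorem mem_algR_iff {q : R} : q ∈ algR ↔ ∀ d, q.coeff d ∈ Qbar := by
  constructor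
  · rintro ⟨p, rfl⟩ d
    simp [MvPolynomial.coeff_map]
  · intro h
    rw [q.as_sum]
    refine sum_mem fun d _ => ⟨MvPolynomial.monomial d ⟨_, h d⟩, ?_⟩
    rw [MvPolynomial.map_monomial]
    rfl

theorem C_mem_algR {c : ℂ} (hc : c ∈ Qbar) : MvPolynomial.C c ∈ algR :=
  ⟨MvPolynomial.C ⟨c, hc⟩, by simp⟩

theorem X_mem_algR (i : Fin 2) : (MvPolynomial.X i : R) ∈ algR := ⟨MvPolynomial.X i, by simp⟩

theorem pderiv_mem_algR {q : R} (h : q ∈ algR) (i : Fin 2) : MvPolynomial.pderiv i q ∈ algR := by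
  obtain ⟨q, rfl⟩ := h
  exact ⟨MvPolynomial.pderiv i q, by rw [MvPolynomial.pderiv_map]⟩

/-- Coefficientwise partial derivative on `ℂ[x, y][s]`. -/
noncomputable def sPartial (i : Fin 2) (Q : R[X]) : R[X] :=
  ∑ k ∈ Finset.range (Q.natDegree + 1), Polynomial.monomial k (MvPolynomial.pderiv i (Q.coeff k))

theorem coeff_sPartial (i : Fin 2) (Q : R[X]) (k : ℕ) :
    (sPartial i Q).coeff k = MvPolynomial.pderiv i (Q.coeff k) := by
  rw [sPartial, Polynomial.finsetSum_coeff]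
  simp only [Polynomial.coeff_monomial]
  rw [Finset.sum_ite_eq' _ _ _]
  split_ifs with h
  · rfl
  · rw [Finset.mem_range, not_lt] at h
    rw [Polynomial.coeff_eq_zero_of_natDegree_lt (by omega), map_zero]

theorem sPartial_mul (i : Fin 2) (P Q : R[X]) :
    sPartial i (P * Q) = P * sPartial i Q + sPartial i P * Q := by
  ext1 k
  rw [coeff_sPartial, Polynomial.coeff_add, Polynomial.coeff_mul, Polynomial.coeff_mul,
    Polynomial.coeff_mul, map_sum, ← Finset.sum_add_distrib]
  refine Finset.sum_congr rfl fun p _ => ?_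
  rw [Derivation.leibniz, coeff_sPartial, coeff_sPartial, smul_eq_mul, smul_eq_mul]
  ring

theorem sPartial_mem_algRX {Q : R[X]} (h : Q ∈ algRX) (i : Fin 2) : sPartial i Q ∈ algRX :=
  fun k => by rw [coeff_sPartial]; exact pderiv_mem_algR (h k) i

theorem eval_C_eq_sum (Q : R[X]) (s : ℂ) :
    Q.eval (MvPolynomial.C s) =
      ∑ k ∈ Finset.range (Q.natDegree + 1), MvPolynomial.C (s ^ k) * Q.coeff k := by
  rw [Polynomial.eval_eq_sum_range]
  exact Finset.sum_congr rfl fun k _ => by rw [map_pow, mul_comm]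

theorem eval_sPartial (i : Fin 2) (Q : R[X]) (s : ℂ) :
    (sPartial i Q).eval (MvPolynomial.C s) = MvPolynomial.pderiv i (Q.eval (MvPolynomial.C s)) := by
  rw [sPartial, Polynomial.eval_finsetSum, eval_C_eq_sum, map_sum]
  refine Finset.sum_congr rfl fun k _ => ?_
  rw [Polynomial.eval_monomial, MvPolynomial.pderiv_C_mul, map_pow, mul_comm]

theorem aeval_mem_algPoly {q : R} (hq : q ∈ algR) {A B : ℂ[X]} (hA : A ∈ algPoly)
    (hB : B ∈ algPoly) : MvPolynomial.aeval ![A, B] q ∈ algPoly := by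
  rw [MvPolynomial.aeval_def]
  refine MvPolynomial.eval₂_mem (fun d _ => C_mem_algPoly (mem_algR_iff.1 hq d)) fun i => ?_
  fin_cases i
  · exact hA
  · exact hB

/-! ### Evaluation at real points -/

/-- The value of `q ∈ ℂ[x, y]` at a real point. -/
noncomputable def ev (q : R) (x y : ℝ) : ℂ := MvPolynomial.eval ![(x : ℂ), (y : ℂ)] q

/-- The value of `f ∈ ℝ[x, y]` at a real point. -/
noncomputable def evR (f : MvPolynomial (Fin 2) ℝ) (x y : ℝ) : ℝ := MvPolynomial.eval ![x, y] f

theorem ev_toC (f : MvPolynomial (Fin 2) ℝ) (x y : ℝ) : ev (toC f) x y = (evR f x y : ℂ) := by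
  have : (![(x : ℂ), (y : ℂ)] : Fin 2 → ℂ) = fun i => (algebraMap ℝ ℂ) (![x, y] i) := by
    ext i; fin_cases i <;> rfl
  rw [ev, evR, toC, this, MvPolynomial.eval_map]
  exact (MvPolynomial.eval₂_comp (algebraMap ℝ ℂ) ![x, y] f).symm

theorem ev_add (p q : R) (x y : ℝ) : ev (p + q) x y = ev p x y + ev q x y := map_add _ _ _
theorem ev_mul (p q : R) (x y : ℝ) : ev (p * q) x y = ev p x y * ev q x y := map_mul _ _ _
theorem ev_C (c : ℂ) (x y : ℝ) : ev (MvPolynomial.C c) x y = c := MvPolynomial.eval_C _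
theorem ev_sum {ι : Type*} (t : Finset ι) (q : ι → R) (x y : ℝ) :
    ev (∑ i ∈ t, q i) x y = ∑ i ∈ t, ev (q i) x y := map_sum _ _ _

theorem continuous_ev (q : R) {X : Type*} [TopologicalSpace X] {a b : X → ℝ} (ha : Continuous a)
    (hb : Continuous b) : Continuous fun x => ev q (a x) (b x) := by
  have h : Continuous fun x => (![(a x : ℂ), (b x : ℂ)] : Fin 2 → ℂ) := by
    refine continuous_pi fun i => ?_
    fin_cases i
    · exact Complex.continuous_ofReal.comp ha
    · exact Complex.continuous_ofReal.comp hb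
  exact (MvPolynomial.continuous_eval q).comp h

theorem continuous_evR (f : MvPolynomial (Fin 2) ℝ) {X : Type*} [TopologicalSpace X] {a b : X → ℝ}
    (ha : Continuous a) (hb : Continuous b) : Continuous fun x => evR f (a x) (b x) := by
  have h : Continuous fun x => (![a x, b x] : Fin 2 → ℝ) := by
    refine continuous_pi fun i => ?_
    fin_cases i
    · exact ha
    · exact hb
  exact (MvPolynomial.continuous_eval f).comp h

theorem hasDerivAt_ev (q : R) {a b : ℝ → ℝ} {a' b' t : ℝ} (ha : HasDerivAt a a' t)
    (hb : HasDerivAt b b' t) :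
    HasDerivAt (fun t => ev q (a t) (b t))
      (ev (MvPolynomial.pderiv 0 q) (a t) (b t) * a' +
        ev (MvPolynomial.pderiv 1 q) (a t) (b t) * b') t := by
  induction q using MvPolynomial.induction_on with
  | C c => simpa [ev_C, ev] using hasDerivAt_const t c
  | add p q hp hq =>
    simp only [ev_add, map_add]
    exact (hp.add hq).congr_deriv (by ring)
  | mul_X p i hp =>
    have hX : HasDerivAt (fun t => ev (MvPolynomial.X i) (a t) (b t))
        (ev (MvPolynomial.pderiv 0 (MvPolynomial.X i)) (a t) (b t) * a' +
          ev (MvPolynomial.pderiv 1 (MvPolynomial.X i)) (a t) (b t) * b') t := by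
      fin_cases i
      · simpa [ev, MvPolynomial.pderiv_X] using ha.ofReal_comp
      · simpa [ev, MvPolynomial.pderiv_X] using hb.ofReal_comp
    simp only [ev_mul, Derivation.leibniz, ev_add, smul_eq_mul]
    exact (hp.mul hX).congr_deriv (by ring)

/-! ### Stokes' formula for `q f ^ s` -/

/-- The numerator of `∂ᵢ (q f ^ z) = (f ∂ᵢ q + z (∂ᵢ f) q) f ^ (z - 1)`. -/
noncomputable def numPartial (f : R) (i : Fin 2) (z : ℂ) (q : R) : R :=
  f * MvPolynomial.pderiv i q + MvPolynomial.C z * (MvPolynomial.pderiv i f * q)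

variable {f : MvPolynomial (Fin 2) ℝ}

theorem hasDerivAt_ev_mul_cpow (q : R) (z : ℂ) {a b : ℝ → ℝ} {a' b' t : ℝ}
    (ha : HasDerivAt a a' t) (hb : HasDerivAt b b' t) (hpos : 0 < evR f (a t) (b t)) :
    HasDerivAt (fun t => ev q (a t) (b t) * (evR f (a t) (b t) : ℂ) ^ z)
      ((ev (numPartial (toC f) 0 z q) (a t) (b t) * a' +
        ev (numPartial (toC f) 1 z q) (a t) (b t) * b') * (evR f (a t) (b t) : ℂ) ^ (z - 1)) t := by
  have hne : (evR f (a t) (b t) : ℂ) ≠ 0 := by exact_mod_cast hpos.ne'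
  have h1 := hasDerivAt_ev (toC f) ha hb
  simp only [ev_toC] at h1
  have h2 : HasDerivAt (fun t => (evR f (a t) (b t) : ℂ) ^ z) _ t :=
    HasDerivAt.comp (h₂ := fun w : ℂ => w ^ z) t
      ((hasStrictDerivAt_id _).hasDerivAt.cpow_const (c := z)
        (Complex.ofReal_mem_slitPlane.2 hpos)) h1
  refine ((hasDerivAt_ev q ha hb).mul h2).congr_deriv ?_
  have h3 : (evR f (a t) (b t) : ℂ) ^ z =
      (evR f (a t) (b t) : ℂ) ^ (z - 1) * (evR f (a t) (b t) : ℂ) := by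
    rw [Complex.cpow_sub _ _ hne, Complex.cpow_one]
    field_simp
  simp only [numPartial, ev_add, ev_mul, ev_C, ev_toC]
  rw [h3]
  ring

theorem continuous_ev_mul_cpow (q : R) {z : ℂ} (hz : 0 < z.re) {X : Type*} [TopologicalSpace X]
    {a b : X → ℝ} (ha : Continuous a) (hb : Continuous b) :
    Continuous fun x => ev q (a x) (b x) * (evR f (a x) (b x) : ℂ) ^ z :=
  (continuous_ev q ha hb).mul ((Complex.continuous_ofReal_cpow_const hz).comp
    (continuous_evR f ha hb))

/-- The unit square, without its left and lower edges. -/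
def square : Set (ℝ × ℝ) := Set.Ioc 0 1 ×ˢ Set.Ioc 0 1

theorem measurableSet_square : MeasurableSet square := measurableSet_Ioc.prod measurableSet_Ioc

theorem _root_.Continuous.integrableOn_square {A : ℝ × ℝ → ℂ} (hA : Continuous A) :
    IntegrableOn A square :=
  (hA.continuousOn.integrableOn_compact (isCompact_Icc (a := (0 : ℝ)) (b := 1) |>.prod
    (isCompact_Icc (a := (0 : ℝ)) (b := 1)))).mono_set
    (Set.prod_mono Set.Ioc_subset_Icc_self Set.Ioc_subset_Icc_self)

theorem integral_square_snd {A A' : ℝ × ℝ → ℂ} (hA : Continuous A) (hA' : Continuous A')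
    (h : ∀ t ∈ Set.Ioc (0 : ℝ) 1, ∀ v ∈ Set.Ioo (0 : ℝ) 1,
      HasDerivAt (fun v => A (t, v)) (A' (t, v)) v) :
    ∫ x in square, A' x = (∫ t in (0 : ℝ)..1, A (t, 1)) - ∫ t in (0 : ℝ)..1, A (t, 0) := by
  rw [square, Measure.volume_eq_prod, setIntegral_prod _ hA'.integrableOn_square,
    ← intervalIntegral.integral_sub (Continuous.intervalIntegrable (by fun_prop) _ _)
    (Continuous.intervalIntegrable (by fun_prop) _ _),
    intervalIntegral.integral_of_le zero_le_one]
  refine setIntegral_congr_fun measurableSet_Ioc fun t ht => ?_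
  rw [← intervalIntegral.integral_of_le zero_le_one]
  exact intervalIntegral.integral_eq_sub_of_hasDerivAt_of_le zero_le_one
    (Continuous.continuousOn (by fun_prop)) (h t ht)
    (Continuous.intervalIntegrable (by fun_prop) _ _)

theorem integral_square_fst {A A' : ℝ × ℝ → ℂ} (hA : Continuous A) (hA' : Continuous A')
    (h : ∀ v ∈ Set.Ioc (0 : ℝ) 1, ∀ t ∈ Set.Ioo (0 : ℝ) 1,
      HasDerivAt (fun t => A (t, v)) (A' (t, v)) t) :
    ∫ x in square, A' x = (∫ v in (0 : ℝ)..1, A (1, v)) - ∫ v in (0 : ℝ)..1, A (0, v) := by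
  have hs : Continuous fun x : ℝ × ℝ => (x.2, x.1) := by fun_prop
  refine Eq.trans ?_ (integral_square_snd (hA.comp hs) (hA'.comp hs) h)
  rw [square, Measure.volume_eq_prod]
  exact (setIntegral_prod_swap _ _ A').symm

/-- The polynomials `f` and `Y` have algebraic coefficients, and `f` is positive on the image of the
closed unit square under `(t, v) ↦ (t ^ m, v Y(t))`, except perhaps at the points mapped to the
origin. -/
structure Admissible (f : MvPolynomial (Fin 2) ℝ) (m : ℕ) (Y : ℝ[X]) : Prop where
  m_pos : 0 < m
  f_mem : toC f ∈ algR
  Y_mem : Y.map (algebraMap ℝ ℂ) ∈ algPoly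
  pos : ∀ t ∈ Set.Ioc (0 : ℝ) 1, ∀ v ∈ Set.Icc (0 : ℝ) 1, 0 < evR f (t ^ m) (v * Y.eval t)
  pos_left : Y.eval 0 ≠ 0 → ∀ v ∈ Set.Ioc (0 : ℝ) 1, 0 < evR f 0 (v * Y.eval 0)

/-- The integral of `Q(s) f ^ (s - n)` over `D_Y`, in the coordinates `(t, v)` with `x = t ^ m` and
`y = v Y(t)`. -/
noncomputable def squareIntegral (f : MvPolynomial (Fin 2) ℝ) (m : ℕ) (Y : ℝ[X]) (Q : R[X]) (n : ℕ)
    (s : ℂ) : ℂ :=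
  ∫ x in square, (ev (Q.eval (MvPolynomial.C s)) (x.1 ^ m) (x.2 * Y.eval x.1) *
    (evR f (x.1 ^ m) (x.2 * Y.eval x.1) : ℂ) ^ (s - n)) * ((m * x.1 ^ (m - 1) * Y.eval x.1 : ℝ) : ℂ)

variable {m : ℕ} {Y : ℝ[X]}

/-- Green's formula for `∂_y`. -/
theorem integral_square_numPartial_one (h : Admissible f m Y) (q : R) {z : ℂ} (hz : 1 < z.re) :
    ∫ x in square, (ev (numPartial (toC f) 1 z q) (x.1 ^ m) (x.2 * Y.eval x.1) *
        (evR f (x.1 ^ m) (x.2 * Y.eval x.1) : ℂ) ^ (z - 1)) *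
          ((m * x.1 ^ (m - 1) * Y.eval x.1 : ℝ) : ℂ) =
      (∫ t in (0 : ℝ)..1, ((m * t ^ (m - 1) : ℝ) : ℂ) *
        (ev q (t ^ m) (Y.eval t) * (evR f (t ^ m) (Y.eval t) : ℂ) ^ z)) -
      ∫ t in (0 : ℝ)..1, ((m * t ^ (m - 1) : ℝ) : ℂ) *
        (ev q (t ^ m) 0 * (evR f (t ^ m) 0 : ℂ) ^ z) := by
  have hz1 : 0 < (z - 1).re := by simpa using hz
  have key := integral_square_snd
    (A := fun x => ((m * x.1 ^ (m - 1) : ℝ) : ℂ) * (ev q (x.1 ^ m) (x.2 * Y.eval x.1) *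
      (evR f (x.1 ^ m) (x.2 * Y.eval x.1) : ℂ) ^ z))
    (A' := fun x => (ev (numPartial (toC f) 1 z q) (x.1 ^ m) (x.2 * Y.eval x.1) *
        (evR f (x.1 ^ m) (x.2 * Y.eval x.1) : ℂ) ^ (z - 1)) *
          ((m * x.1 ^ (m - 1) * Y.eval x.1 : ℝ) : ℂ)) ?_ ?_ ?_
  · simpa using key
  · exact (by fun_prop : Continuous fun x : ℝ × ℝ => ((m * x.1 ^ (m - 1) : ℝ) : ℂ)).mul
      (continuous_ev_mul_cpow q (by linarith) (by fun_prop) (by fun_prop))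
  · exact (continuous_ev_mul_cpow _ hz1 (by fun_prop) (by fun_prop)).mul (by fun_prop)
  · intro t ht v hv
    have := hasDerivAt_ev_mul_cpow (f := f) q z (a := fun _ => t ^ m) (b := fun v => v * Y.eval t)
      (hasDerivAt_const v _) ((hasDerivAt_id v).mul_const _) (h.pos t ht v ⟨hv.1.le, hv.2.le⟩)
    refine (this.const_mul ((m * t ^ (m - 1) : ℝ) : ℂ)).congr_deriv ?_
    push_cast
    ring

/-- Green's formula for `∂_x`. In the coordinates `(t, v)`, the form `∂_x h dx dy` is the
divergence `∂_t (Y h) - ∂_v (v Y' h)`. -/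
theorem integral_square_numPartial_zero (h : Admissible f m Y) (q : R) {z : ℂ} (hz : 1 < z.re) :
    ∫ x in square, (ev (numPartial (toC f) 0 z q) (x.1 ^ m) (x.2 * Y.eval x.1) *
        (evR f (x.1 ^ m) (x.2 * Y.eval x.1) : ℂ) ^ (z - 1)) *
          ((m * x.1 ^ (m - 1) * Y.eval x.1 : ℝ) : ℂ) =
      (∫ v in (0 : ℝ)..1, ((Y.eval 1 : ℝ) : ℂ) *
        (ev q 1 (v * Y.eval 1) * (evR f 1 (v * Y.eval 1) : ℂ) ^ z)) -
      (∫ v in (0 : ℝ)..1, ((Y.eval 0 : ℝ) : ℂ) *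
        (ev q 0 (v * Y.eval 0) * (evR f 0 (v * Y.eval 0) : ℂ) ^ z)) -
      ∫ t in (0 : ℝ)..1, (((derivative Y).eval t : ℝ) : ℂ) *
        (ev q (t ^ m) (Y.eval t) * (evR f (t ^ m) (Y.eval t) : ℂ) ^ z) := by
  have hz1 : 0 < (z - 1).re := by simpa using hz
  have hz0 : 0 < z.re := by linarith
  set W : ℝ × ℝ → ℂ := fun x => ev q (x.1 ^ m) (x.2 * Y.eval x.1) *
      (evR f (x.1 ^ m) (x.2 * Y.eval x.1) : ℂ) ^ z with hW
  set D : Fin 2 → ℝ × ℝ → ℂ := fun i x =>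
    ev (numPartial (toC f) i z q) (x.1 ^ m) (x.2 * Y.eval x.1) *
        (evR f (x.1 ^ m) (x.2 * Y.eval x.1) : ℂ) ^ (z - 1) with hD
  have hWc : Continuous W := continuous_ev_mul_cpow q hz0 (by fun_prop) (by fun_prop)
  have hDc : ∀ i, Continuous (D i) := fun i =>
    continuous_ev_mul_cpow _ hz1 (by fun_prop) (by fun_prop)
  have hY' : ∀ t, HasDerivAt (fun t => ((Y.eval t : ℝ) : ℂ)) (((derivative Y).eval t : ℝ) : ℂ) t :=
    fun t => (Y.hasDerivAt t).ofReal_comp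
  -- the two divergence terms
  set T : ℝ × ℝ → ℂ := fun x => ((((derivative Y).eval x.1 : ℝ) : ℂ)) * W x +
    ((Y.eval x.1 : ℝ) : ℂ) * (D 0 x * ((m * x.1 ^ (m - 1) : ℝ) : ℂ) +
      D 1 x * ((x.2 * (derivative Y).eval x.1 : ℝ) : ℂ)) with hT
  set V : ℝ × ℝ → ℂ := fun x => ((((derivative Y).eval x.1 : ℝ) : ℂ)) * W x +
    ((x.2 * (derivative Y).eval x.1 : ℝ) : ℂ) * (D 1 x * ((Y.eval x.1 : ℝ) : ℂ)) with hV
  have c1 : Continuous fun x : ℝ × ℝ => ((Y.eval x.1 : ℝ) : ℂ) := by fun_prop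
  have c2 : Continuous fun x : ℝ × ℝ => (((derivative Y).eval x.1 : ℝ) : ℂ) := by fun_prop
  have c3 : Continuous fun x : ℝ × ℝ => ((m * x.1 ^ (m - 1) : ℝ) : ℂ) := by fun_prop
  have c4 : Continuous fun x : ℝ × ℝ => ((x.2 * (derivative Y).eval x.1 : ℝ) : ℂ) := by fun_prop
  have hTc : Continuous T :=
    (c2.mul hWc).add (c1.mul (((hDc 0).mul c3).add ((hDc 1).mul c4)))
  have hVc : Continuous V := (c2.mul hWc).add (c4.mul ((hDc 1).mul c1))
  have key1 := integral_square_fst (A := fun x => ((Y.eval x.1 : ℝ) : ℂ) * W x) (A' := T)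
    (c1.mul hWc) hTc ?_
  · have key2 := integral_square_snd
      (A := fun x => ((x.2 * (derivative Y).eval x.1 : ℝ) : ℂ) * W x) (A' := V)
      (c4.mul hWc) hVc ?_
    · have hsub : (fun x : ℝ × ℝ => D 0 x * ((m * x.1 ^ (m - 1) * Y.eval x.1 : ℝ) : ℂ)) =
          fun x => T x - V x := by
        ext x
        simp only [hT, hV]
        push_cast
        ring
      change ∫ x in square, D 0 x * ((m * x.1 ^ (m - 1) * Y.eval x.1 : ℝ) : ℂ) = _
      rw [hsub, integral_sub hTc.integrableOn_square hVc.integrableOn_square, key1, key2]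
      simp [hW, h.m_pos.ne']
    · intro t ht v hv
      have := hasDerivAt_ev_mul_cpow (f := f) q z (a := fun _ => t ^ m) (b := fun v => v * Y.eval t)
        (hasDerivAt_const v _) ((hasDerivAt_id v).mul_const _) (h.pos t ht v ⟨hv.1.le, hv.2.le⟩)
      have h2 : HasDerivAt (fun v : ℝ => ((v * (derivative Y).eval t : ℝ) : ℂ))
          ((((derivative Y).eval t : ℝ) : ℂ)) v := by
        simpa using ((hasDerivAt_id v).mul_const ((derivative Y).eval t)).ofReal_comp
      refine (h2.mul this).congr_deriv ?_
      simp only [hV, hW, hD]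
      push_cast
      ring
  · intro v hv t ht
    have := hasDerivAt_ev_mul_cpow (f := f) q z (a := fun t => t ^ m) (b := fun t => v * Y.eval t)
      (hasDerivAt_pow m t) ((Y.hasDerivAt t).const_mul v) (h.pos t ⟨ht.1, ht.2.le⟩ v
        ⟨hv.1.le, hv.2⟩)
    refine ((hY' t).mul this).congr_deriv ?_
    simp only [hT, hW, hD]
    push_cast
    ring

/-! ### The boundary integrals -/

/-- The real polynomials in one variable with algebraic coefficients. -/
noncomputable abbrev algRealPoly : Subring ℝ[X] :=
  algPoly.comap (Polynomial.mapRingHom (algebraMap ℝ ℂ))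

theorem X_mem_algRealPoly : (Polynomial.X : ℝ[X]) ∈ algRealPoly := by
  rw [Subring.mem_comap, Polynomial.coe_mapRingHom, Polynomial.map_X]
  exact X_mem_algPoly

theorem C_mem_algRealPoly {c : ℝ} (h : (c : ℂ) ∈ Qbar) : Polynomial.C c ∈ algRealPoly := by
  rw [Subring.mem_comap, Polynomial.coe_mapRingHom, Polynomial.map_C]
  exact C_mem_algPoly h

theorem ofReal_eval (a : ℝ[X]) (t : ℝ) :
    ((a.eval t : ℝ) : ℂ) = (a.map (algebraMap ℝ ℂ)).eval (t : ℂ) :=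
  (Polynomial.eval_map_apply Complex.ofRealHom t).symm

theorem ofReal_eval_mem_Qbar {a : ℝ[X]} (h : a ∈ algRealPoly) {c : ℝ} (hc : (c : ℂ) ∈ Qbar) :
    ((a.eval c : ℝ) : ℂ) ∈ Qbar := by
  rw [ofReal_eval]
  exact eval_mem_Qbar h hc

theorem ev_eval (q : R) (a b : ℝ[X]) (t : ℝ) : ev q (a.eval t) (b.eval t) =
    (MvPolynomial.aeval ![a.map (algebraMap ℝ ℂ), b.map (algebraMap ℝ ℂ)] q).eval (t : ℂ) := by
  induction q using MvPolynomial.induction_on with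
  | C c => simp [ev_C]
  | add p q hp hq => simp only [ev_add, map_add, hp, hq, Polynomial.eval_add]
  | mul_X p i hp =>
    rw [ev_mul, hp, map_mul, Polynomial.eval_mul, MvPolynomial.aeval_X]
    congr 1
    fin_cases i
    · simpa [ev] using ofReal_eval a t
    · simpa [ev] using ofReal_eval b t

theorem eval_aeval_real (f : MvPolynomial (Fin 2) ℝ) (a b : ℝ[X]) (t : ℝ) :
    (MvPolynomial.aeval ![a, b] f).eval t = evR f (a.eval t) (b.eval t) := by
  induction f using MvPolynomial.induction_on with
  | C c => simp [evR]
  | add p q hp hq => simp_all [evR]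
  | mul_X p i hp =>
    simp only [evR, map_mul, Polynomial.eval_mul, MvPolynomial.aeval_X, MvPolynomial.eval_X] at hp ⊢
    rw [hp]
    congr 1
    fin_cases i <;> rfl

theorem map_aeval_real (f : MvPolynomial (Fin 2) ℝ) (a b : ℝ[X]) :
    (MvPolynomial.aeval ![a, b] f).map (algebraMap ℝ ℂ) =
      MvPolynomial.aeval ![a.map (algebraMap ℝ ℂ), b.map (algebraMap ℝ ℂ)] (toC f) := by
  refine Polynomial.eq_of_infinite_eval_eq _ _ (Set.Infinite.mono (s := Set.range Complex.ofReal)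
    ?_ (Set.infinite_range_of_injective Complex.ofReal_injective))
  rintro _ ⟨t, rfl⟩
  rw [Set.mem_ofPred_eq, ← ofReal_eval, eval_aeval_real, ← ev_eval, ev_toC]

/-- The integral of `Q(s) f ^ (s - n)` along a polynomial arc. -/
theorem hasAlgCont_arc (hf : toC f ∈ algR) {a b J : ℝ[X]} (ha : a ∈ algRealPoly)
    (hb : b ∈ algRealPoly) (hJ : J ∈ algRealPoly)
    (hpos : ∀ t ∈ Set.Ioc (0 : ℝ) 1, 0 < evR f (a.eval t) (b.eval t)) {Q : R[X]} (hQ : Q ∈ algRX)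
    (n : ℕ) :
    HasAlgCont fun s => ∫ t in (0 : ℝ)..1, ((J.eval t : ℝ) : ℂ) *
      (ev (Q.eval (MvPolynomial.C s)) (a.eval t) (b.eval t) *
        (evR f (a.eval t) (b.eval t) : ℂ) ^ (s - n)) := by
  set p : ℝ[X] := MvPolynomial.aeval ![a, b] f with hp
  have hpe : ∀ t, p.eval t = evR f (a.eval t) (b.eval t) := eval_aeval_real f a b
  have hpQ : p.map (algebraMap ℝ ℂ) ∈ algPoly := by
    rw [hp, map_aeval_real]
    exact aeval_mem_algPoly hf ha hb
  set q : ℕ → ℂ[X] := fun k => J.map (algebraMap ℝ ℂ) *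
    MvPolynomial.aeval ![a.map (algebraMap ℝ ℂ), b.map (algebraMap ℝ ℂ)] (Q.coeff k) with hq
  have hqQ : ∀ k, q k ∈ algPoly := fun k => mul_mem hJ (aeval_mem_algPoly (hQ k) ha hb)
  have hmain : HasAlgCont fun s => ∑ k ∈ Finset.range (Q.natDegree + 1), s ^ k *
      ∫ t in (0 : ℝ)..1, ((p.eval t : ℝ) : ℂ) ^ (s + ((-n : ℚ) : ℂ)) * (q k).eval (t : ℂ) := by
    refine HasAlgCont.sum _ fun k _ => HasAlgCont.mul (by fun_prop) (fun z hz => pow_mem hz k) ?_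
    exact (hasAlgCont_integral_cpow (fun t ht => by rw [hpe]; exact hpos t ht) hpQ
      (hqQ k)).comp_add (-n : ℚ)
  refine hmain.congr (σ := n) fun s hs => ?_
  have hs' : 0 < (s + ((-n : ℚ) : ℂ)).re := by simpa using hs
  simp_rw [← intervalIntegral.integral_const_mul]
  rw [← intervalIntegral.integral_finsetSum]
  · refine intervalIntegral.integral_congr fun t _ => ?_
    simp only [hpe, hq]
    rw [eval_C_eq_sum, ev_sum, Finset.sum_mul, Finset.mul_sum]
    refine Finset.sum_congr rfl fun k _ => ?_
    rw [ev_mul, ev_C, ev_eval, Polynomial.eval_mul, ← ofReal_eval]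
    push_cast
    rw [← sub_eq_add_neg]
    ring
  · intro k _
    refine Continuous.intervalIntegrable ?_ _ _
    refine continuous_const.mul (((Complex.continuous_ofReal_cpow_const hs').comp
      p.continuous).mul ?_)
    exact (q k).continuous.comp Complex.continuous_ofReal

/-! ### Integration by parts on the square -/

/-- The numerator of `∂ᵢ (Q f ^ (s - n))`, over the denominator `f ^ (n + 1 - s)`. -/
noncomputable def sNumPartial (f : R) (i : Fin 2) (n : ℕ) (Q : R[X]) : R[X] :=
  Polynomial.C f * sPartial i Q +
    (Polynomial.X - Polynomial.C (n : R)) * (Polynomial.C (MvPolynomial.pderiv i f) * Q)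

theorem eval_sNumPartial (f : R) (i : Fin 2) (n : ℕ) (Q : R[X]) (s : ℂ) :
    (sNumPartial f i n Q).eval (MvPolynomial.C s) =
      numPartial f i (s - n) (Q.eval (MvPolynomial.C s)) := by
  simp [sNumPartial, numPartial, eval_sPartial]

theorem sNumPartial_mem_algRX {f : R} (hf : f ∈ algR) (i : Fin 2) (n : ℕ) {Q : R[X]}
    (hQ : Q ∈ algRX) : sNumPartial f i n Q ∈ algRX :=
  add_mem (mul_mem (C_mem_coeffSubring hf) (sPartial_mem_algRX hQ i))
    (mul_mem (sub_mem X_mem_coeffSubring (C_mem_coeffSubring (natCast_mem _ n)))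
      (mul_mem (C_mem_coeffSubring (pderiv_mem_algR hf i)) hQ))

theorem sNumPartial_mul (f : R) (i : Fin 2) (n : ℕ) (V Q : R[X]) :
    sNumPartial f i n (V * Q) =
      V * sNumPartial f i n Q + Polynomial.C f * (sPartial i V * Q) := by
  rw [sNumPartial, sNumPartial, sPartial_mul]
  ring

theorem hasAlgCont_squareIntegral_sNumPartial (h : Admissible f m Y) (i : Fin 2) (n : ℕ) {Q : R[X]}
    (hQ : Q ∈ algRX) :
    HasAlgCont (squareIntegral f m Y (sNumPartial (toC f) i n Q) (n + 1)) := by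
  have hY : Y ∈ algRealPoly := h.Y_mem
  have h0 : Y.eval 0 ∈ (Qbar.toSubring.comap (algebraMap ℝ ℂ)) :=
    ofReal_eval_mem_Qbar hY (by simp)
  have h1 : ((Y.eval 1 : ℝ) : ℂ) ∈ Qbar := ofReal_eval_mem_Qbar hY (by simp)
  have hY' : derivative Y ∈ algRealPoly := by
    rw [Subring.mem_comap, Polynomial.coe_mapRingHom, ← derivative_map]
    exact derivative_mem_algPoly hY
  have hXm : ∀ k, (Polynomial.X ^ k : ℝ[X]) ∈ algRealPoly := fun k => pow_mem X_mem_algRealPoly k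
  have hpos1 : ∀ t ∈ Set.Ioc (0 : ℝ) 1, 0 < evR f (t ^ m) (Y.eval t) := fun t ht => by
    simpa using h.pos t ht 1 (by simp)
  have hz : ∀ s : ℂ, ((n + 2 : ℕ) : ℝ) < s.re → 1 < (s - n).re := fun s hs => by
    push_cast at hs
    rw [Complex.sub_re, Complex.natCast_re]
    linarith
  have hexp : ∀ s : ℂ, s - ((n + 1 : ℕ) : ℂ) = s - n - 1 := fun s => by push_cast; ring
  have top := fun (J : ℝ[X]) hJ => hasAlgCont_arc (n := n) h.f_mem (hXm m) hY (J := J) hJ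
    (by simpa using hpos1) hQ
  have hmJ : (Polynomial.C (m : ℝ) * Polynomial.X ^ (m - 1) : ℝ[X]) ∈ algRealPoly :=
    mul_mem (C_mem_algRealPoly (by simp)) (hXm _)
  have heval : ∀ c t : ℝ, (Polynomial.X * Polynomial.C c).eval t = t * c := fun c t => by
    rw [Polynomial.eval_mul, Polynomial.eval_X, Polynomial.eval_C]
  fin_cases i
  · have right := hasAlgCont_arc (n := n) h.f_mem (one_mem algRealPoly)
      (mul_mem X_mem_algRealPoly (C_mem_algRealPoly h1)) (C_mem_algRealPoly h1)
      (fun t ht => by simpa [-X_mul_C, heval] using h.pos 1 (by simp) t ⟨ht.1.le, ht.2⟩) hQ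
    have left : HasAlgCont fun s => ∫ v in (0 : ℝ)..1, ((Y.eval 0 : ℝ) : ℂ) *
        (ev (Q.eval (MvPolynomial.C s)) 0 (v * Y.eval 0) *
          (evR f 0 (v * Y.eval 0) : ℂ) ^ (s - n)) := by
      by_cases hY0 : Y.eval 0 = 0
      · simpa [hY0] using HasAlgCont.zero
      · simpa [-X_mul_C, heval] using hasAlgCont_arc (n := n) h.f_mem (zero_mem algRealPoly)
          (mul_mem X_mem_algRealPoly (C_mem_algRealPoly h0)) (C_mem_algRealPoly h0)
          (fun t ht => by simpa [-X_mul_C, heval] using h.pos_left hY0 t ht) hQ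
    refine ((right.sub left).sub (top _ hY')).congr (σ := (n + 2 : ℕ)) fun s hs => ?_
    have := integral_square_numPartial_zero h (Q.eval (MvPolynomial.C s)) (hz s hs)
    simp only [squareIntegral, eval_sNumPartial, hexp]
    refine this.trans ?_
    simp [-X_mul_C, heval]
  · have bottom := hasAlgCont_arc (n := n) h.f_mem (hXm m) (zero_mem algRealPoly) hmJ
      (fun t ht => by simpa using h.pos t ht 0 (by simp)) hQ
    refine ((top _ hmJ).sub bottom).congr (σ := (n + 2 : ℕ)) fun s hs => ?_
    have := integral_square_numPartial_one h (Q.eval (MvPolynomial.C s)) (hz s hs)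
    simp only [squareIntegral, eval_sNumPartial, hexp]
    refine this.trans ?_
    simp

theorem integrableOn_squareIntegral (Q : R[X]) (n : ℕ) {s : ℂ} (hs : n < s.re) :
    IntegrableOn (fun x : ℝ × ℝ =>
      (ev (Q.eval (MvPolynomial.C s)) (x.1 ^ m) (x.2 * Y.eval x.1) *
      (evR f (x.1 ^ m) (x.2 * Y.eval x.1) : ℂ) ^ (s - n)) *
        ((m * x.1 ^ (m - 1) * Y.eval x.1 : ℝ) : ℂ)) square := by
  refine Continuous.integrableOn_square ?_
  exact (continuous_ev_mul_cpow _ (by simpa using hs) (by fun_prop) (by fun_prop)).mul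
    (by fun_prop)

theorem squareIntegral_add (P Q : R[X]) (n : ℕ) {s : ℂ} (hs : n < s.re) :
    squareIntegral f m Y (P + Q) n s =
      squareIntegral f m Y P n s + squareIntegral f m Y Q n s := by
  simp only [squareIntegral]
  rw [← integral_add (integrableOn_squareIntegral P n hs) (integrableOn_squareIntegral Q n hs)]
  simp only [Polynomial.eval_add, ev_add, add_mul]

theorem squareIntegral_sum {ι : Type*} (t : Finset ι) (Q : ι → R[X]) (n : ℕ) {s : ℂ}
    (hs : n < s.re) :
    squareIntegral f m Y (∑ i ∈ t, Q i) n s = ∑ i ∈ t, squareIntegral f m Y (Q i) n s := by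
  classical
  induction t using Finset.induction_on with
  | empty => simp [squareIntegral, ev]
  | insert a t ha ih => rw [Finset.sum_insert ha, Finset.sum_insert ha, squareIntegral_add _ _ _ hs,
      ih]

theorem squareIntegral_const_mul (B : ℂ[X]) (Q : R[X]) (n : ℕ) (s : ℂ) :
    squareIntegral f m Y (B.map MvPolynomial.C * Q) n s =
      B.eval s * squareIntegral f m Y Q n s := by
  simp only [squareIntegral]
  rw [← integral_const_mul]
  simp only [Polynomial.eval_mul, ev_mul, Polynomial.eval_map_apply, ev_C, mul_assoc]

/-- Common powers of `f` in the numerator and the denominator cancel. -/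
theorem squareIntegral_pow_mul (h : Admissible f m Y) (Q : R[X]) (n k : ℕ) (s : ℂ) :
    squareIntegral f m Y (Polynomial.C (toC f) ^ k * Q) (n + k) s =
      squareIntegral f m Y Q n s := by
  simp only [squareIntegral]
  refine setIntegral_congr_fun measurableSet_square fun x hx => ?_
  have hpos := h.pos x.1 hx.1 x.2 ⟨hx.2.1.le, hx.2.2⟩
  have hne : (evR f (x.1 ^ m) (x.2 * Y.eval x.1) : ℂ) ≠ 0 := by exact_mod_cast hpos.ne'
  have hexp : s - ((n + k : ℕ) : ℂ) = s - n - k := by push_cast; ring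
  simp only [hexp, Polynomial.eval_mul, Polynomial.eval_pow, Polynomial.eval_C]
  rw [ev_mul, Complex.cpow_sub _ _ hne, Complex.cpow_natCast,
    show ev (toC f ^ k) (x.1 ^ m) (x.2 * Y.eval x.1) = _ from map_pow _ _ _]
  change (ev (toC f) _ _ ^ k * _ * _) * _ = _
  rw [ev_toC]
  field_simp

theorem hasAlgCont_by_parts (h : Admissible f m Y) (i : Fin 2) (n : ℕ) {V Q : R[X]}
    (hV : V ∈ algRX) (hQ : Q ∈ algRX) :
    HasAlgCont fun s => squareIntegral f m Y (V * sNumPartial (toC f) i n Q) (n + 1) s -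
      squareIntegral f m Y ((-sPartial i V) * Q) n s := by
  refine (hasAlgCont_squareIntegral_sNumPartial h i n (mul_mem hV hQ)).congr
    (σ := ((n + 1 : ℕ) : ℝ)) fun s hs => ?_
  have hs' : (n : ℝ) < s.re := by push_cast at hs; linarith
  have h1 := squareIntegral_pow_mul h (sPartial i V * Q) n 1 s
  have h2 := squareIntegral_const_mul (f := f) (m := m) (Y := Y) (-1) (sPartial i V * Q) n s
  rw [pow_one] at h1
  rw [sNumPartial_mul, squareIntegral_add _ _ _ hs, h1]
  have h3 : (-sPartial i V) * Q = (-1 : ℂ[X]).map MvPolynomial.C * (sPartial i V * Q) := by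
    rw [Polynomial.map_neg, Polynomial.map_one]; ring
  rw [h3, h2]
  simp

/-- The numerator of `∂ᵢ ^ k (Q f ^ (s - n))`, over the denominator `f ^ (n + k - s)`. -/
noncomputable def iterNumPartial (f : R) (i : Fin 2) (n : ℕ) (Q : R[X]) : ℕ → R[X]
  | 0 => Q
  | k + 1 => sNumPartial f i (n + k) (iterNumPartial f i n Q k)

theorem iterNumPartial_mem_algRX {f : R} (hf : f ∈ algR) (i : Fin 2) (n : ℕ) {Q : R[X]}
    (hQ : Q ∈ algRX) (k : ℕ) : iterNumPartial f i n Q k ∈ algRX := by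
  induction k with
  | zero => exact hQ
  | succ k ih => exact sNumPartial_mem_algRX hf i _ ih

/-- Repeated integration by parts moves `∂ᵢ ^ k` to the weight. -/
theorem exists_iterated_by_parts (h : Admissible f m Y) (i : Fin 2) (n : ℕ) {Q : R[X]}
    (hQ : Q ∈ algRX) (k : ℕ) {V : R[X]} (hV : V ∈ algRX) :
    ∃ V' ∈ algRX, HasAlgCont fun s =>
      squareIntegral f m Y (V * iterNumPartial (toC f) i n Q k) (n + k) s -
        squareIntegral f m Y (V' * Q) n s := by
  induction k generalizing V with
  | zero => exact ⟨V, hV, by simpa [iterNumPartial] using HasAlgCont.zero⟩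
  | succ k ih =>
    have h1 := hasAlgCont_by_parts h i (n + k) hV (iterNumPartial_mem_algRX h.f_mem i n hQ k)
    obtain ⟨V', hV', h2⟩ := ih (neg_mem (sPartial_mem_algRX hV i))
    refine ⟨V', hV', (h1.add h2).congr (σ := 0) fun s _ => ?_⟩
    simp [iterNumPartial, add_assoc]

/-! ### Clearing denominators in the functional equation -/

theorem coeff_sum_locPartial (f : R) (i : Fin 2) (u : (Loc f)[X]) (k : ℕ) :
    (u.sum fun k c => Polynomial.monomial k (locPartial f i c)).coeff k =
      locPartial f i (u.coeff k) := by
  rw [Polynomial.sum_def, Polynomial.finsetSum_coeff]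
  simp only [Polynomial.coeff_monomial]
  rw [Finset.sum_ite_eq' _ _ _]
  split_ifs with h
  · rfl
  · rw [Polynomial.notMem_support_iff.1 h, locPartial_zero]

/-- If `u = Q / f ^ n`, then the numerator of `∂ᵢ (u f ^ s)` over `f ^ (n + 1)` is
`sNumPartial f i n Q`. -/
theorem pow_mul_nabla {f : R} {i : Fin 2} {n : ℕ} {u : (Loc f)[X]} {Q : R[X]}
    (h : Polynomial.C (algebraMap R (Loc f) f) ^ n * u = Q.map (algebraMap R (Loc f))) :
    Polynomial.C (algebraMap R (Loc f) f) ^ (n + 1) * nabla f i u =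
      (sNumPartial f i n Q).map (algebraMap R (Loc f)) := by
  set ι := algebraMap R (Loc f) with hι
  set D := u.sum fun k c => Polynomial.monomial k (locPartial f i c) with hD
  have hinv : ι f * IsLocalization.Away.invSelf f = 1 :=
    IsLocalization.Away.mul_invSelf f
  have h1 : Polynomial.C (ι f) ^ (n + 1) * D = Polynomial.C (ι f) * (sPartial i Q).map ι -
      Polynomial.C (n * ι (MvPolynomial.pderiv i f)) * Q.map ι := by
    ext1 k
    have hk : ι (f ^ n) * u.coeff k = ι (Q.coeff k) := by
      have := congrArg (fun w => w.coeff k) h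
      simp only [← Polynomial.C_pow, Polynomial.coeff_C_mul, Polynomial.coeff_map] at this
      rw [map_pow, this]
    have hk' := congrArg (locPartial f i) hk
    rw [locPartial_mul, locPartial_algebraMap, locPartial_algebraMap, ← hι,
      Derivation.leibniz_pow, smul_eq_mul, nsmul_eq_mul, map_mul, map_mul, map_natCast] at hk'
    rw [← Polynomial.C_pow, Polynomial.coeff_C_mul, hD, coeff_sum_locPartial,
      Polynomial.coeff_sub, Polynomial.coeff_C_mul, Polynomial.coeff_C_mul, Polynomial.coeff_map,
      Polynomial.coeff_map, coeff_sPartial, ← hk', ← hk]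
    rcases n with - | n
    · simp
    · simp only [map_pow, Nat.add_sub_cancel]
      ring
  have h2 : Polynomial.C (ι f) * Polynomial.C (ι (MvPolynomial.pderiv i f) *
      IsLocalization.Away.invSelf f) = Polynomial.C (ι (MvPolynomial.pderiv i f)) := by
    rw [← Polynomial.C_mul]
    congr 1
    linear_combination ι (MvPolynomial.pderiv i f) * hinv
  have h3 : (sNumPartial f i n Q).map ι = Polynomial.C (ι f) * (sPartial i Q).map ι +
      (Polynomial.X - Polynomial.C (n : Loc f)) *
        (Polynomial.C (ι (MvPolynomial.pderiv i f)) * Q.map ι) := by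
    simp [sNumPartial]
  rw [h3, nabla, mul_add, h1, ← h, Polynomial.C_mul]
  linear_combination (Polynomial.X * Polynomial.C (ι f) ^ n * u) * h2

/-- The numerator of `∂ₓ ^ i ∂_y ^ j f ^ (s + 1)`, over the denominator `f ^ (i + j - s)`. -/
noncomputable def opNum (f : R) (I : ℕ × ℕ) : R[X] :=
  iterNumPartial f 0 I.2 (iterNumPartial f 1 0 (Polynomial.C f) I.2) I.1

theorem pow_mul_iterate_nabla {f : R} {i : Fin 2} {n : ℕ} {u : (Loc f)[X]} {Q : R[X]}
    (h : Polynomial.C (algebraMap R (Loc f) f) ^ n * u = Q.map (algebraMap R (Loc f))) (k : ℕ) :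
    Polynomial.C (algebraMap R (Loc f) f) ^ (n + k) * (nabla f i)^[k] u =
      (iterNumPartial f i n Q k).map (algebraMap R (Loc f)) := by
  induction k with
  | zero => exact h
  | succ k ih =>
    rw [Function.iterate_succ_apply', iterNumPartial, ← add_assoc]
    exact pow_mul_nabla ih

theorem pow_mul_opNum (f : R) (I : ℕ × ℕ) :
    Polynomial.C (algebraMap R (Loc f) f) ^ (I.2 + I.1) *
      (nabla f 0)^[I.1] ((nabla f 1)^[I.2] (Polynomial.C (algebraMap R (Loc f) f))) =
        (opNum f I).map (algebraMap R (Loc f)) := by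
  refine pow_mul_iterate_nabla ?_ I.1
  have := pow_mul_iterate_nabla (f := f) (i := 1) (n := 0)
    (u := Polynomial.C (algebraMap R (Loc f) f)) (Q := Polynomial.C f) (by simp) I.2
  rwa [zero_add] at this

/-- The functional equation `P f ^ (s + 1) = B(s) f ^ s` as an identity of polynomials. -/
theorem exists_polynomial_functional_equation {f : R} (hf : f ≠ 0) {B : ℂ[X]}
    (hB : B ∈ bernsteinIdeal f) :
    ∃ (P : ℕ × ℕ → R[X]) (t : Finset (ℕ × ℕ)) (N : ℕ), (∀ I ∈ t, I.2 + I.1 ≤ N) ∧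
      ∑ I ∈ t, P I * (opNum f I * Polynomial.C f ^ (N - (I.2 + I.1))) =
        B.map MvPolynomial.C * Polynomial.C f ^ N := by
  obtain ⟨P, hP⟩ := hB
  set N := P.support.sup fun I => I.2 + I.1 with hN
  have hle : ∀ I ∈ P.support, I.2 + I.1 ≤ N := fun I hI =>
    Finset.le_sup (f := fun I : ℕ × ℕ => I.2 + I.1) hI
  refine ⟨P, P.support, N, hle, ?_⟩
  have hinj : Function.Injective (algebraMap R (Loc f)) :=
    IsLocalization.injective (Loc f) (powers_le_nonZeroDivisors_of_noZeroDivisors hf)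
  apply Polynomial.map_injective _ hinj
  have hBm : (B.map MvPolynomial.C).map (algebraMap R (Loc f)) = B.map (algebraMap ℂ (Loc f)) := by
    rw [Polynomial.map_map]
    rfl
  rw [Polynomial.map_mul, hBm, ← hP, applyOp, Finsupp.sum, Finset.sum_mul, Polynomial.map_sum]
  refine Finset.sum_congr rfl fun I hI => ?_
  have h1 := pow_mul_opNum f I
  rw [Polynomial.map_mul, Polynomial.map_mul, ← h1, Polynomial.map_pow, Polynomial.map_pow,
    Polynomial.map_C]
  have h2 : Polynomial.C (algebraMap R (Loc f) f) ^ N =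
      Polynomial.C (algebraMap R (Loc f) f) ^ (I.2 + I.1) *
        Polynomial.C (algebraMap R (Loc f) f) ^ (N - (I.2 + I.1)) := by
    rw [← pow_add, Nat.add_sub_cancel' (hle I hI)]
  rw [h2]
  ring

/-! ### Descent of the functional equation to algebraic coefficients -/

/-- Apply a linear form `ℂ → Qbar` to the coefficients of a polynomial in `ℂ[x, y]`. -/
noncomputable def coeffMap (l : ℂ →ₗ[Qbar] Qbar) (q : R) : R :=
  ∑ d ∈ q.support, MvPolynomial.monomial d (l (q.coeff d) : ℂ)

theorem coeff_coeffMap (l : ℂ →ₗ[Qbar] Qbar) (q : R) (d : Fin 2 →₀ ℕ) :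
    (coeffMap l q).coeff d = l (q.coeff d) := by
  classical
  rw [coeffMap, MvPolynomial.coeff_sum]
  simp only [MvPolynomial.coeff_monomial]
  rw [Finset.sum_ite_eq' _ _ _]
  split_ifs with h
  · rfl
  · rw [MvPolynomial.notMem_support_iff.1 h, map_zero]
    rfl

theorem map_mul_of_mem (l : ℂ →ₗ[Qbar] Qbar) (z : ℂ) {c : ℂ} (hc : c ∈ Qbar) :
    (l (z * c) : ℂ) = l z * c := by
  have : z * c = (⟨c, hc⟩ : Qbar) • z := by
    rw [mul_comm]; rfl
  rw [this, map_smul, mul_comm]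
  rfl

theorem coeffMap_mem_algR (l : ℂ →ₗ[Qbar] Qbar) (q : R) : coeffMap l q ∈ algR :=
  mem_algR_iff.2 fun d => by rw [coeff_coeffMap]; exact (l _).2

theorem coeffMap_add (l : ℂ →ₗ[Qbar] Qbar) (p q : R) :
    coeffMap l (p + q) = coeffMap l p + coeffMap l q := by
  ext d
  simp only [MvPolynomial.coeff_add, coeff_coeffMap, map_add]
  rfl

/-- `coeffMap` as an additive map. -/
noncomputable def coeffMapHom (l : ℂ →ₗ[Qbar] Qbar) : R →+ R :=
  AddMonoidHom.mk' (coeffMap l) (coeffMap_add l)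

theorem coeffMap_mul (l : ℂ →ₗ[Qbar] Qbar) (p : R) {q : R} (hq : q ∈ algR) :
    coeffMap l (p * q) = coeffMap l p * q := by
  classical
  ext d
  rw [coeff_coeffMap, MvPolynomial.coeff_mul, MvPolynomial.coeff_mul, map_sum,
    AddSubmonoidClass.coe_finsetSum]
  refine Finset.sum_congr rfl fun x _ => ?_
  rw [coeff_coeffMap, map_mul_of_mem l _ (mem_algR_iff.1 hq _)]

/-- Apply a linear form `ℂ → Qbar` to the coefficients of a polynomial in `ℂ[x, y][s]`. -/
noncomputable def sCoeffMap (l : ℂ →ₗ[Qbar] Qbar) (Q : R[X]) : R[X] :=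
  ∑ k ∈ Q.support, Polynomial.monomial k (coeffMap l (Q.coeff k))

theorem coeff_sCoeffMap (l : ℂ →ₗ[Qbar] Qbar) (Q : R[X]) (k : ℕ) :
    (sCoeffMap l Q).coeff k = coeffMap l (Q.coeff k) := by
  rw [sCoeffMap, Polynomial.finsetSum_coeff]
  simp only [Polynomial.coeff_monomial]
  rw [Finset.sum_ite_eq' _ _ _]
  split_ifs with h
  · rfl
  · rw [Polynomial.notMem_support_iff.1 h]
    exact (map_zero (coeffMapHom l)).symm

theorem sCoeffMap_mem_algRX (l : ℂ →ₗ[Qbar] Qbar) (Q : R[X]) : sCoeffMap l Q ∈ algRX := fun k => by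
  rw [coeff_sCoeffMap]
  exact coeffMap_mem_algR l _

theorem sCoeffMap_mul (l : ℂ →ₗ[Qbar] Qbar) (P : R[X]) {Q : R[X]} (hQ : Q ∈ algRX) :
    sCoeffMap l (P * Q) = sCoeffMap l P * Q := by
  ext1 k
  rw [coeff_sCoeffMap, Polynomial.coeff_mul, Polynomial.coeff_mul]
  refine (map_sum (coeffMapHom l) _ _).trans (Finset.sum_congr rfl fun x _ => ?_)
  rw [coeff_sCoeffMap]
  exact coeffMap_mul l _ (hQ x.2)

theorem sCoeffMap_sum (l : ℂ →ₗ[Qbar] Qbar) {ι : Type*} (t : Finset ι) (Q : ι → R[X]) :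
    sCoeffMap l (∑ i ∈ t, Q i) = ∑ i ∈ t, sCoeffMap l (Q i) := by
  ext1 k
  rw [coeff_sCoeffMap, Polynomial.finsetSum_coeff, Polynomial.finsetSum_coeff]
  simp only [coeff_sCoeffMap]
  exact map_sum (coeffMapHom l) _ _

theorem sCoeffMap_map_C (l : ℂ →ₗ[Qbar] Qbar) (B : ℂ[X]) :
    ∃ B' ∈ algPoly, sCoeffMap l (B.map MvPolynomial.C) = B'.map MvPolynomial.C ∧
      ∀ k, B'.coeff k = l (B.coeff k) := by
  set B' : ℂ[X] := ∑ k ∈ B.support, Polynomial.monomial k (l (B.coeff k) : ℂ) with hB'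
  have hc : ∀ k, B'.coeff k = l (B.coeff k) := by
    intro k
    rw [hB', Polynomial.finsetSum_coeff]
    simp only [Polynomial.coeff_monomial]
    rw [Finset.sum_ite_eq' _ _ _]
    split_ifs with h
    · rfl
    · rw [Polynomial.notMem_support_iff.1 h, map_zero]
      rfl
  refine ⟨B', mem_algPoly_iff.2 fun k => by rw [hc]; exact (l _).2, ?_, hc⟩
  ext k d
  rw [coeff_sCoeffMap, coeff_coeffMap, Polynomial.coeff_map, Polynomial.coeff_map, hc,
    MvPolynomial.coeff_C, MvPolynomial.coeff_C]
  split_ifs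
  · rfl
  · rw [map_zero]; rfl

theorem exists_linearForm_eval_ne_zero {B : ℂ[X]} {α : ℂ} (hB : B.eval α ≠ 0) :
    ∃ l : ℂ →ₗ[Qbar] Qbar, ∀ B' ∈ algPoly, (∀ k, B'.coeff k = l (B.coeff k)) →
      B'.eval α ≠ 0 := by
  have hdual : ∀ z : ℂ, z ≠ 0 → ∃ l : ℂ →ₗ[Qbar] Qbar, l z ≠ 0 := by
    intro z hz
    by_contra! h
    exact hz ((Module.forall_dual_apply_eq_zero_iff Qbar z).1 h)
  by_cases hα : α ∈ Qbar
  · obtain ⟨l, hl⟩ := hdual _ hB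
    refine ⟨l, fun B' _ hc h0 => hl ?_⟩
    have hdeg : B'.natDegree < B.natDegree + 1 := by
      rw [Nat.lt_succ_iff, Polynomial.natDegree_le_iff_coeff_eq_zero]
      intro k hk
      rw [hc, Polynomial.coeff_eq_zero_of_natDegree_lt hk, map_zero]
      rfl
    rw [Polynomial.eval_eq_sum_range' hdeg] at h0
    rw [Polynomial.eval_eq_sum_range, map_sum]
    apply Subtype.ext
    rw [AddSubmonoidClass.coe_finsetSum, ZeroMemClass.coe_zero, ← h0]
    refine Finset.sum_congr rfl fun k _ => ?_
    rw [map_mul_of_mem l _ (pow_mem hα k), hc]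
  · have hB0 : B ≠ 0 := by rintro rfl; simp at hB
    obtain ⟨l, hl⟩ := hdual _ (Polynomial.leadingCoeff_ne_zero.2 hB0)
    refine ⟨l, fun B' hB' hc h0 => hα ?_⟩
    obtain ⟨b, rfl⟩ := hB'
    rw [mem_algebraicClosure_iff]
    have hb : IsAlgebraic Qbar α := by
      refine ⟨b, ?_, ?_⟩
      · rintro rfl
        have := hc B.natDegree
        simp only [map_zero, Polynomial.coeff_zero] at this
        exact hl (Subtype.ext this.symm)
      · rwa [Polynomial.coe_mapRingHom, Polynomial.eval_map_algebraMap] at h0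
    have : Algebra.IsAlgebraic ℚ Qbar := ⟨fun x =>
      (isAlgebraic_algebraMap_iff (algebraMap Qbar ℂ).injective).1 (mem_algebraicClosure_iff.1 x.2)⟩
    exact hb.restrictScalars ℚ

/-- The functional equation over `ℂ` may be replaced by one with algebraic coefficients whose
right-hand side is still nonzero at the given point. -/
theorem exists_algebraic_functional_equation {f : R} (hf : f ≠ 0) (hfQ : f ∈ algR) {B : ℂ[X]}
    (hB : B ∈ bernsteinIdeal f) {α : ℂ} (hα : B.eval α ≠ 0) :
    ∃ B' ∈ algPoly, B'.eval α ≠ 0 ∧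
      ∃ (P : ℕ × ℕ → R[X]) (t : Finset (ℕ × ℕ)) (N : ℕ), (∀ I, P I ∈ algRX) ∧
        (∀ I ∈ t, I.2 + I.1 ≤ N) ∧
        ∑ I ∈ t, P I * (opNum f I * Polynomial.C f ^ (N - (I.2 + I.1))) =
          B'.map MvPolynomial.C * Polynomial.C f ^ N := by
  obtain ⟨P, t, N, hN, h⟩ := exists_polynomial_functional_equation hf hB
  obtain ⟨l, hl⟩ := exists_linearForm_eval_ne_zero hα
  obtain ⟨B', hB', hB'm, hc⟩ := sCoeffMap_map_C l B
  refine ⟨B', hB', hl B' hB' hc, fun I => sCoeffMap l (P I), t, N,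
    fun I => sCoeffMap_mem_algRX l _, hN, ?_⟩
  have hfX := C_mem_coeffSubring hfQ
  have h' := congrArg (sCoeffMap l) h
  rw [sCoeffMap_sum, sCoeffMap_mul l _ (pow_mem hfX N), hB'm] at h'
  rw [← h']
  refine Finset.sum_congr rfl fun I _ => (sCoeffMap_mul l _ ?_).symm
  exact mul_mem (iterNumPartial_mem_algRX hfQ _ _ (iterNumPartial_mem_algRX hfQ _ _ hfX _) _)
    (pow_mem hfX _)

/-! ### The functional equation of the integrals -/

/-- The integral of `w f ^ s` over `D_Y`, in the coordinates of the unit square. -/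
noncomputable def weightIntegral (f : MvPolynomial (Fin 2) ℝ) (m : ℕ) (Y : ℝ[X]) (w : R) : ℂ → ℂ :=
  squareIntegral f m Y (Polynomial.C w) 0

/-- The right-hand side of the functional equation is expressed by integrals at `s + 1`. -/
theorem squareIntegral_mul_C (h : Admissible f m Y) (V : R[X]) {s : ℂ} (hs : 0 < s.re) :
    squareIntegral f m Y (V * Polynomial.C (toC f)) 0 s =
      ∑ k ∈ Finset.range (V.natDegree + 1), s ^ k * weightIntegral f m Y (V.coeff k) (s + 1) := by
  conv_lhs => rw [V.as_sum_range_C_mul_X_pow, Finset.sum_mul]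
  rw [squareIntegral_sum _ _ _ (by simpa using hs)]
  refine Finset.sum_congr rfl fun k _ => ?_
  have h1 : Polynomial.C (V.coeff k) * Polynomial.X ^ k * Polynomial.C (toC f) =
      (Polynomial.X ^ k : ℂ[X]).map MvPolynomial.C * Polynomial.C (V.coeff k * toC f) := by
    rw [Polynomial.map_pow, Polynomial.map_X, Polynomial.C_mul]
    ring
  rw [h1, squareIntegral_const_mul, Polynomial.eval_pow, Polynomial.eval_X]
  congr 1
  simp only [weightIntegral, squareIntegral]
  refine setIntegral_congr_fun measurableSet_square fun x hx => ?_
  have hpos := h.pos x.1 hx.1 x.2 ⟨hx.2.1.le, hx.2.2⟩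
  have hne : (evR f (x.1 ^ m) (x.2 * Y.eval x.1) : ℂ) ≠ 0 := by exact_mod_cast hpos.ne'
  simp only [Polynomial.eval_C, Nat.cast_zero, sub_zero]
  rw [ev_mul, ev_toC, Complex.cpow_add _ _ hne, Complex.cpow_one]
  ring

theorem differentiableOn_weightIntegral (h : Admissible f m Y) (w : R) :
    DifferentiableOn ℂ (weightIntegral f m Y w) {s | 0 < s.re} := by
  have key := differentiableOn_integral_cpow (μ := volume.restrict square)
    (p := fun x : ℝ × ℝ => evR f (x.1 ^ m) (x.2 * Y.eval x.1))
    (W := fun x => ev w (x.1 ^ m) (x.2 * Y.eval x.1) *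
      ((m * x.1 ^ (m - 1) * Y.eval x.1 : ℝ) : ℂ)) (S := Set.Ioi 0)
    (continuous_evR f (by fun_prop) (by fun_prop)).measurable
    ((continuous_ev w (by fun_prop) (by fun_prop)).mul (by fun_prop)).aestronglyMeasurable ?_
    isOpen_Ioi ?_
  · refine key.congr fun s _ => ?_
    simp only [weightIntegral, squareIntegral, Polynomial.eval_C, Nat.cast_zero, sub_zero]
    congr 1
    ext x
    ring
  · filter_upwards [ae_restrict_mem measurableSet_square] with x hx
    exact h.pos x.1 hx.1 x.2 ⟨hx.2.1.le, hx.2.2⟩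
  · intro σ hσ
    have := integrableOn_squareIntegral (f := f) (m := m) (Y := Y) (Polynomial.C w) 0
      (s := (σ : ℂ)) (by simpa using hσ)
    refine this.congr (Eventually.of_forall fun x => ?_)
    simp only [Polynomial.eval_C, Nat.cast_zero, sub_zero]
    ring

/-- The functional equation with right-hand side `B` has algebraic coefficients. -/
structure AlgFunctionalEquation (f : R) (B : ℂ[X]) (P : ℕ × ℕ → R[X]) (t : Finset (ℕ × ℕ))
    (N : ℕ) : Prop where
  B_mem : B ∈ algPoly
  P_mem : ∀ I, P I ∈ algRX
  le : ∀ I ∈ t, I.2 + I.1 ≤ N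
  eq : ∑ I ∈ t, P I * (opNum f I * Polynomial.C f ^ (N - (I.2 + I.1))) =
    B.map MvPolynomial.C * Polynomial.C f ^ N

variable {B : ℂ[X]} {P : ℕ × ℕ → R[X]} {t : Finset (ℕ × ℕ)} {N : ℕ}

/-- Integrating the functional equation against a weight and integrating by parts. -/
theorem exists_integrated_functional_equation (h : Admissible f m Y)
    (hB : AlgFunctionalEquation (toC f) B P t N) {w : R} (hw : w ∈ algR) :
    ∃ V ∈ algRX, HasAlgCont fun s => B.eval s * weightIntegral f m Y w s -
      ∑ k ∈ Finset.range (V.natDegree + 1), s ^ k * weightIntegral f m Y (V.coeff k) (s + 1) := by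
  have hfX : Polynomial.C (toC f) ∈ algRX := C_mem_coeffSubring h.f_mem
  have hstep : ∀ I : ℕ × ℕ, ∃ V ∈ algRX, HasAlgCont fun s =>
      squareIntegral f m Y (Polynomial.C w * P I * opNum (toC f) I) (I.2 + I.1) s -
        squareIntegral f m Y (V * Polynomial.C (toC f)) 0 s := by
    intro I
    obtain ⟨V₁, hV₁, h₁⟩ := exists_iterated_by_parts h 0 I.2
      (iterNumPartial_mem_algRX h.f_mem 1 0 hfX I.2) I.1
      (mul_mem (C_mem_coeffSubring hw) (hB.P_mem I))
    obtain ⟨V₂, hV₂, h₂⟩ := exists_iterated_by_parts h 1 0 hfX I.2 hV₁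
    refine ⟨V₂, hV₂, (h₁.add h₂).congr (σ := 0) fun s _ => ?_⟩
    simp only [opNum, zero_add]
    ring
  choose V hV hVA using hstep
  refine ⟨∑ I ∈ t, V I, sum_mem fun I _ => hV I,
    (HasAlgCont.sum t fun I _ => hVA I).congr (σ := N) fun s hs => ?_⟩
  have hs0 : 0 < s.re := (Nat.cast_nonneg N).trans_lt hs
  rw [← squareIntegral_mul_C h _ hs0, Finset.sum_mul, squareIntegral_sum _ _ _ (by simpa using hs0),
    Finset.sum_sub_distrib]
  congr 1
  have h1 := squareIntegral_pow_mul h (Polynomial.C w) 0 N s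
  rw [weightIntegral, ← h1, ← squareIntegral_const_mul]
  have h2 : B.map MvPolynomial.C * (Polynomial.C (toC f) ^ N * Polynomial.C w) =
      ∑ I ∈ t, Polynomial.C (toC f) ^ (N - (I.2 + I.1)) *
        (Polynomial.C w * P I * opNum (toC f) I) := by
    rw [← mul_assoc, ← hB.eq, Finset.sum_mul]
    exact Finset.sum_congr rfl fun I _ => by ring
  rw [h2, zero_add, squareIntegral_sum _ _ _ hs]
  refine Finset.sum_congr rfl fun I hI => ?_
  rw [← squareIntegral_pow_mul h _ (I.2 + I.1) (N - (I.2 + I.1)), Nat.add_sub_cancel' (hB.le I hI)]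

/-- Solving the functional equation for the integral at `s` continues it to ever larger
half-planes. -/
theorem exists_meromorphic_continuation (h : Admissible f m Y)
    (hB : AlgFunctionalEquation (toC f) B P t N) (hB0 : B ≠ 0) {w : R} (hw : w ∈ algR) :
    ∃ G : ℂ → ℂ, Meromorphic G ∧ ∃ σ : ℝ, ∀ s : ℂ, σ < s.re → weightIntegral f m Y w s = G s := by
  have claim : ∀ (k : ℕ) (w : R), w ∈ algR → ∃ G : ℂ → ℂ, MeromorphicOn G {s | 0 - (k : ℝ) < s.re} ∧
      ∃ σ : ℝ, ∀ s : ℂ, σ < s.re → weightIntegral f m Y w s = G s := by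
    intro k
    induction k with
    | zero =>
      intro w _
      refine ⟨_, ?_, 0, fun s _ => rfl⟩
      have := (differentiableOn_weightIntegral h w).analyticOnNhd (isOpen_re_gt 0)
      simpa using this.meromorphicOn
    | succ k ih =>
      intro w hw
      obtain ⟨V, hV, A, hA, σ, hσ⟩ := exists_integrated_functional_equation h hB hw
      choose G hG τ hτ using fun j => ih (V.coeff j) (hV j)
      have hBm : Meromorphic fun s => B.eval s := fun z =>
        (B.differentiable.analyticAt z).meromorphicAt
      refine ⟨fun s => ((∑ j ∈ Finset.range (V.natDegree + 1), s ^ j * G j (s + 1)) + A s) /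
        B.eval s, fun z hz => ?_, ?_⟩
      · have hsum : MeromorphicAt
            (fun s => ∑ j ∈ Finset.range (V.natDegree + 1), s ^ j * G j (s + 1)) z := by
          refine MeromorphicAt.fun_sum fun j _ => ?_
          have hz' : z + 1 ∈ {s : ℂ | 0 - (k : ℝ) < s.re} := by
            rw [Set.mem_ofPred_eq] at hz ⊢
            push_cast at hz
            rw [Complex.add_re, Complex.one_re]
            linarith
          have h1 : MeromorphicAt (fun s => G j (s + 1)) z :=
            (hG j _ hz').comp_analyticAt (g := fun s => s + 1) (by fun_prop)
          exact ((analyticAt_id.pow j).meromorphicAt).mul h1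
        have hAz := hA.meromorphicOn z (Set.mem_univ z)
        exact (hsum.add hAz).div (hBm z)
      · -- far to the right the zeros of `B` are avoided
        obtain ⟨ρ, hρ⟩ : ∃ ρ : ℝ, ∀ s : ℂ, ρ < s.re → B.eval s ≠ 0 := by
          obtain ⟨ρ, hρ⟩ := (B.roots.toFinset.image Complex.re).bddAbove
          refine ⟨ρ, fun s hs h0 => hs.not_ge (hρ ?_)⟩
          simp only [Finset.coe_image, Set.mem_image, Finset.mem_coe, Multiset.mem_toFinset]
          exact ⟨s, (Polynomial.mem_roots hB0).2 h0, rfl⟩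
        obtain ⟨T, hT⟩ := ((Finset.range (V.natDegree + 1)).image τ).bddAbove
        refine ⟨max σ (max ρ T), fun s hs => ?_⟩
        rw [max_lt_iff, max_lt_iff] at hs
        rw [eq_div_iff (hρ s hs.2.1), mul_comm, ← sub_eq_iff_eq_add', ← hσ s hs.1]
        congr 1
        refine Finset.sum_congr rfl fun j hj => ?_
        rw [hτ j (s + 1)]
        have : τ j ≤ T := hT (by simpa using ⟨j, Finset.mem_range.1 hj |> Nat.lt_succ_iff.1, rfl⟩)
        rw [Complex.add_re, Complex.one_re]
        linarith [hs.2.2]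
  choose G hG hGI using fun k => claim k w hw
  obtain ⟨H, hHI, hH⟩ := exists_glue (weightIntegral f m Y w) 0 G hG hGI
  refine ⟨H, fun z => ?_, hHI⟩
  obtain ⟨k, hk⟩ := exists_nat_gt (-z.re)
  have hk' : 0 - (k : ℝ) < z.re := by linarith
  exact (hG k z hk').congr (hH z k hk').symm

/-- If the integrals have no pole at `α + 1` and `B(α) ≠ 0`, then at `α` each of them has at most a
simple pole, with an algebraic residue. -/
theorem isAlgebraic_residue (h : Admissible f m Y) (hB : AlgFunctionalEquation (toC f) B P t N)
    {α : ℂ} (hBα : B.eval α ≠ 0)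
    (hα : ∀ w ∈ algR, ∀ G : ℂ → ℂ, Meromorphic G →
      (∃ σ : ℝ, ∀ s : ℂ, σ < s.re → weightIntegral f m Y w s = G s) →
        SimplePoleAt G (α + 1) 0)
    {w : R} (hw : w ∈ algR) {F : ℂ → ℂ} (hF : Meromorphic F)
    (hFw : ∃ σ : ℝ, ∀ s : ℂ, σ < s.re → weightIntegral f m Y w s = F s) :
    ∃ r ∈ Qbar, SimplePoleAt F α r := by
  have hB0 : B ≠ 0 := by rintro rfl; simp at hBα
  obtain ⟨V, hV, A, hA, σ, hσ⟩ := exists_integrated_functional_equation h hB hw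
  choose G hG τ hτ using fun j => exists_meromorphic_continuation h hB hB0 (hV j)
  obtain ⟨σ', hσ'⟩ := hFw
  have hBan : ∀ z, AnalyticAt ℂ (fun s => B.eval s) z := fun z =>
    B.differentiable.analyticAt z
  set S : ℂ → ℂ := fun s => (∑ j ∈ Finset.range (V.natDegree + 1), s ^ j * G j (s + 1)) + A s
    with hS
  have hterm : ∀ j, SimplePoleAt (fun s => s ^ j * G j (s + 1)) α 0 := fun j => by
    have := (hα _ (hV j) (G j) (hG j) ⟨τ j, hτ j⟩).comp_add.analytic_mul
      (p := fun s => s ^ j) (by fun_prop)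
    simpa using this
  have hsum : SimplePoleAt
      (fun s => ∑ j ∈ Finset.range (V.natDegree + 1), s ^ j * G j (s + 1)) α 0 := by
    induction Finset.range (V.natDegree + 1) using Finset.induction_on with
    | empty => simpa using (analyticAt_const (v := (0 : ℂ))).simplePoleAt
    | insert a t ha ih => simpa [Finset.sum_insert ha] using (hterm a).add ih
  obtain ⟨r, hr, hrα, hAα⟩ := hA α (Set.mem_univ α)
  have hSα : SimplePoleAt S α r := by simpa using hsum.add hAα
  have hSm : Meromorphic S := fun z => by
    refine MeromorphicAt.add (MeromorphicAt.fun_sum fun j _ => ?_) (hA.meromorphicOn z trivial)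
    have h1 : MeromorphicAt (fun s => G j (s + 1)) z :=
      (hG j _).comp_analyticAt (g := fun s => s + 1) (by fun_prop)
    exact ((analyticAt_id.pow j).meromorphicAt).mul h1
  have hBF : Meromorphic fun s => B.eval s * F s := fun z => (hBan z).meromorphicAt.mul (hF z)
  obtain ⟨T, hT⟩ := ((Finset.range (V.natDegree + 1)).image τ).bddAbove
  have heq : (fun s => B.eval s * F s) =ᶠ[𝓝[≠] α] S := by
    refine eventuallyEq_of_meromorphic (σ := max σ (max σ' T)) hBF hSm (fun s hs => ?_) α
    rw [max_lt_iff, max_lt_iff] at hs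
    simp only [hS]
    rw [← hσ' s hs.2.1, ← hσ s hs.1, ← sub_eq_iff_eq_add']
    congr 1
    refine Finset.sum_congr rfl fun j hj => ?_
    rw [hτ j (s + 1)]
    have : τ j ≤ T := hT (by simpa using ⟨j, Finset.mem_range.1 hj |> Nat.lt_succ_iff.1, rfl⟩)
    rw [Complex.add_re, Complex.one_re]
    linarith [hs.2.2]
  have hBF' : SimplePoleAt (fun s => (B.eval s)⁻¹ * S s) α ((B.eval α)⁻¹ * r) :=
    hSα.analytic_mul ((hBan α).inv hBα)
  refine ⟨(B.eval α)⁻¹ * r, ?_, hBF'.congr ?_⟩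
  · by_cases h0 : r = 0
    · simp [h0]
    · exact mul_mem (inv_mem (eval_mem_Qbar hB.B_mem (hrα h0))) hr
  · filter_upwards [heq, nhdsWithin_le_nhds ((hBan α).continuousAt.eventually_ne hBα)] with s hs hs'
    rw [← hs, inv_mul_cancel_left₀ hs']

/-! ### The conjugate product `g_Y` is a polynomial -/

/-- The product `∏ (y - Y(ζ t))` over the `m`-th roots of unity, as a polynomial in `t` over
`ℂ[y]`. -/
noncomputable def conjProd (m : ℕ) (Y : ℂ[X]) : ℂ[X][X] :=
  ∏ ζ ∈ Polynomial.nthRootsFinset m (1 : ℂ),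
    (Polynomial.C Polynomial.X -
      (Y.map Polynomial.C).comp (Polynomial.C (Polynomial.C ζ) * Polynomial.X))

theorem eval_conjProd (m : ℕ) (Y : ℂ[X]) (t y : ℂ) :
    ((conjProd m Y).eval (Polynomial.C t)).eval y =
      ∏ ζ ∈ Polynomial.nthRootsFinset m (1 : ℂ), (y - Y.eval (ζ * t)) := by
  rw [conjProd, Polynomial.eval_prod, Polynomial.eval_prod]
  refine Finset.prod_congr rfl fun ζ _ => ?_
  simp only [Polynomial.eval_sub, Polynomial.eval_C, Polynomial.eval_X, Polynomial.eval_comp,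
    Polynomial.eval_mul]
  rw [← Polynomial.C_mul, Polynomial.eval_map_apply, Polynomial.eval_C]

/-- Replacing `t` by `ω t` permutes the factors of `conjProd`, so only powers of `t ^ m` occur. -/
theorem coeff_conjProd_eq_zero {m : ℕ} (hm : 0 < m) (Y : ℂ[X]) {n : ℕ} (hn : ¬ m ∣ n) :
    (conjProd m Y).coeff n = 0 := by
  have hω := Complex.isPrimitiveRoot_exp m hm.ne'
  set ω := Complex.exp (2 * Real.pi * Complex.I / m) with hωdef
  have hω0 : ω ≠ 0 := Complex.exp_ne_zero _
  have hinv : (conjProd m Y).comp (Polynomial.C (Polynomial.C ω) * Polynomial.X) =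
      conjProd m Y := by
    rw [conjProd, Polynomial.prod_comp]
    refine Finset.prod_bij' (fun ζ _ => ζ * ω) (fun ζ _ => ζ * ω⁻¹) ?_ ?_ ?_ ?_ ?_
    · intro ζ hζ
      rw [Polynomial.mem_nthRootsFinset hm] at hζ ⊢
      rw [mul_pow, hζ, hω.pow_eq_one, one_mul]
    · intro ζ hζ
      rw [Polynomial.mem_nthRootsFinset hm] at hζ ⊢
      rw [mul_pow, inv_pow, hζ, hω.pow_eq_one, inv_one, one_mul]
    · intro ζ _
      rw [mul_assoc, mul_inv_cancel₀ hω0, mul_one]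
    · intro ζ _
      rw [mul_assoc, inv_mul_cancel₀ hω0, mul_one]
    · intro ζ _
      rw [Polynomial.sub_comp, Polynomial.C_comp, Polynomial.comp_assoc]
      congr 2
      rw [Polynomial.mul_comp, Polynomial.C_comp, Polynomial.X_comp, Polynomial.C_mul,
        Polynomial.C_mul, mul_assoc]
  have h := congrArg (fun Q => Q.coeff n) hinv
  simp only [Polynomial.comp_C_mul_X_coeff] at h
  have h2 : (conjProd m Y).coeff n * (Polynomial.C (ω ^ n - 1)) = 0 := by
    rw [Polynomial.C_sub, Polynomial.C_pow, mul_sub, h]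
    simp
  rcases mul_eq_zero.1 h2 with h3 | h3
  · exact h3
  · rw [Polynomial.C_eq_zero, sub_eq_zero] at h3
    exact absurd ((hω.pow_eq_one_iff_dvd n).1 h3) hn

theorem conjProd_mem {m : ℕ} (hm : 0 < m) {Y : ℂ[X]} (hY : Y ∈ algPoly) :
    conjProd m Y ∈ coeffSubring algPoly := by
  refine prod_mem fun ζ hζ => sub_mem (C_mem_coeffSubring X_mem_algPoly) fun n => ?_
  have hζQ : ζ ∈ Qbar := by
    rw [mem_algebraicClosure_iff]
    refine IsAlgebraic.of_pow hm ?_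
    rw [(Polynomial.mem_nthRootsFinset hm _).1 hζ]
    exact isAlgebraic_one
  rw [Polynomial.comp_C_mul_X_coeff, Polynomial.coeff_map]
  exact mul_mem (C_mem_algPoly (mem_algPoly_iff.1 hY n)) (pow_mem (C_mem_algPoly hζQ) n)

/-- The polynomial in `x` and `y` that `conjProd` becomes when `t ^ m = x`. -/
noncomputable def gPoly (m : ℕ) (Y : ℂ[X]) : R :=
  (Polynomial.contract m (conjProd m Y)).eval₂
    (Polynomial.aeval (MvPolynomial.X 1 : R) : ℂ[X] →ₐ[ℂ] R).toRingHom (MvPolynomial.X 0)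

theorem gPoly_mem_algR {m : ℕ} (hm : 0 < m) {Y : ℂ[X]} (hY : Y ∈ algPoly) : gPoly m Y ∈ algR := by
  rw [gPoly, Polynomial.eval₂_eq_sum_range]
  refine sum_mem fun k _ => mul_mem ?_ (pow_mem (X_mem_algR 0) k)
  rw [Polynomial.coeff_contract hm.ne']
  have h := conjProd_mem hm hY (k * m)
  change Polynomial.aeval (MvPolynomial.X 1 : R) _ ∈ algR
  rw [Polynomial.aeval_eq_sum_range]
  refine sum_mem fun j _ => ?_
  rw [MvPolynomial.smul_eq_C_mul]
  exact mul_mem (C_mem_algR (mem_algPoly_iff.1 h j)) (pow_mem (X_mem_algR 1) j)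

theorem ev_gPoly {m : ℕ} (hm : 0 < m) (Y : ℂ[X]) (t y : ℝ) :
    ev (gPoly m Y) (t ^ m) y =
      ∏ ζ ∈ Polynomial.nthRootsFinset m (1 : ℂ), ((y : ℂ) - Y.eval (ζ * t)) := by
  rw [← eval_conjProd]
  have hexp : Polynomial.expand ℂ[X] m (Polynomial.contract m (conjProd m Y)) = conjProd m Y := by
    ext1 n
    rw [Polynomial.coeff_expand hm]
    split_ifs with h
    · rw [Polynomial.coeff_contract hm.ne', Nat.div_mul_cancel h]
    · exact (coeff_conjProd_eq_zero hm Y h).symm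
  conv_rhs => rw [← hexp, Polynomial.expand_eval, ← Polynomial.C_pow]
  rw [ev, gPoly, Polynomial.hom_eval₂, Polynomial.eval₂_eq_sum_range,
    Polynomial.eval_eq_sum_range (p := Polynomial.contract m (conjProd m Y)),
    Polynomial.eval_finsetSum]
  refine Finset.sum_congr rfl fun k _ => ?_
  rw [Polynomial.eval_mul, ← Polynomial.C_pow, Polynomial.eval_C]
  congr 1
  · change (MvPolynomial.eval _) (Polynomial.aeval (MvPolynomial.X 1 : R) _) = _
    rw [Polynomial.aeval_def, Polynomial.hom_eval₂]
    simp only [MvPolynomial.eval_X]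
    rw [Polynomial.eval, Matrix.cons_val_one, Matrix.cons_val_fin_one]
    congr 1
    ext
    simp
  · simp

/-! ### The integrals in the coordinates of the unit square -/

/-- The parametrization `(t, v) ↦ (t ^ m, v Y(t))` of `D_Y` by the unit square. -/
noncomputable def squareMap (m : ℕ) (Y : ℝ[X]) (x : ℝ × ℝ) : ℝ × ℝ :=
  (x.1 ^ m, x.2 * Y.eval x.1)

/-- The derivative of `squareMap`. -/
noncomputable def squareMapDeriv (m : ℕ) (Y : ℝ[X]) (x : ℝ × ℝ) : ℝ × ℝ →L[ℝ] ℝ × ℝ :=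
  LinearMap.toContinuousLinearMap (Matrix.toLin (Module.Basis.finTwoProd ℝ)
    (Module.Basis.finTwoProd ℝ)
    !![m * x.1 ^ (m - 1), 0; x.2 * (derivative Y).eval x.1, Y.eval x.1])

theorem det_squareMapDeriv (x : ℝ × ℝ) :
    (squareMapDeriv m Y x).det = m * x.1 ^ (m - 1) * Y.eval x.1 := by
  rw [ContinuousLinearMap.det, squareMapDeriv, LinearMap.coe_toContinuousLinearMap,
    LinearMap.det_toLin, Matrix.det_fin_two_of]
  ring

theorem hasFDerivAt_squareMap (x : ℝ × ℝ) :
    HasFDerivAt (squareMap m Y) (squareMapDeriv m Y x) x := by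
  have h1 : HasFDerivAt (fun x : ℝ × ℝ => x.1 ^ m) _ x :=
    (hasDerivAt_pow m x.1).comp_hasFDerivAt x (hasFDerivAt_fst (𝕜 := ℝ))
  have h2 : HasFDerivAt (fun x : ℝ × ℝ => x.2 * Y.eval x.1) _ x :=
    (hasFDerivAt_snd (𝕜 := ℝ)).mul
      ((Y.hasDerivAt x.1).comp_hasFDerivAt x (hasFDerivAt_fst (𝕜 := ℝ)))
  refine (h1.prodMk h2).congr_fderiv ?_
  ext <;> simp [squareMapDeriv, Matrix.toLin_finTwoProd_apply]

theorem rpow_one_div_pow (hm : 0 < m) {t : ℝ} (ht : 0 ≤ t) : (t ^ m) ^ ((1 : ℝ) / m) = t := by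
  rw [one_div, Real.pow_rpow_inv_natCast ht hm.ne']

theorem injOn_squareMap (hm : 0 < m) (hY : ∀ t ∈ Set.Ioc (0 : ℝ) 1, 0 < Y.eval t) :
    Set.InjOn (squareMap m Y) square := by
  rintro ⟨t, v⟩ ⟨ht, _⟩ ⟨t', v'⟩ ⟨ht', _⟩ h
  simp only [squareMap, Prod.mk.injEq] at h
  have htt : t = t' := (pow_left_inj₀ ht.1.le ht'.1.le hm.ne').1 h.1
  subst htt
  rw [Prod.mk.injEq]
  exact ⟨rfl, mul_right_cancel₀ (hY t ht).ne' h.2⟩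

/-- Up to the coordinate axes, `D_Y` is the image of the square. -/
theorem domainD_ae_eq_image (hm : 0 < m) (hY : ∀ t ∈ Set.Ioc (0 : ℝ) 1, 0 < Y.eval t) :
    domainD m Y =ᵐ[volume] squareMap m Y '' square := by
  have hnull : ∀ᵐ p : ℝ × ℝ, p.1 ≠ 0 ∧ p.2 ≠ 0 := by
    have h0 : ∀ᵐ x : ℝ, x ≠ 0 := by simp [ae_iff]
    rw [Measure.volume_eq_prod]
    exact (Measure.quasiMeasurePreserving_fst.ae h0).and
      (Measure.quasiMeasurePreserving_snd.ae h0)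
  filter_upwards [hnull] with p hp
  refine propext ⟨fun h => ?_, ?_⟩
  · obtain ⟨h1, h2, h3, h4⟩ := h
    have hx : 0 < p.1 := lt_of_le_of_ne h1 (Ne.symm hp.1)
    have hy : 0 < p.2 := lt_of_le_of_ne h3 (Ne.symm hp.2)
    set t := p.1 ^ ((1 : ℝ) / m) with ht
    have ht0 : 0 < t := Real.rpow_pos_of_pos hx _
    have ht1 : t ≤ 1 := Real.rpow_le_one h1 h2 (by positivity)
    have hYt := hY t ⟨ht0, ht1⟩
    refine ⟨(t, p.2 / Y.eval t), ⟨⟨ht0, ht1⟩, div_pos hy hYt, (div_le_one hYt).2 h4⟩, ?_⟩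
    rw [squareMap]
    refine Prod.ext ?_ ?_
    · simp only [ht, one_div]
      exact Real.rpow_inv_natCast_pow h1 hm.ne'
    · exact div_mul_cancel₀ _ hYt.ne'
  · rintro ⟨⟨t, v⟩, ⟨ht, hv⟩, rfl⟩
    refine ⟨pow_nonneg ht.1.le m, pow_le_one₀ ht.1.le ht.2, ?_, ?_⟩
    · exact mul_nonneg hv.1.le (hY t ht).le
    · simp only [squareMap, rpow_one_div_pow hm ht.1.le]
      exact mul_le_of_le_one_left (hY t ht).le hv.2

/-- The polynomial weight `x ^ (β₁ - 1) y ^ (β₂ - 1) g_Y ^ β₃`. -/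
noncomputable def betaWeight (m : ℕ) (Y : ℝ[X]) (β₁ β₂ β₃ : ℕ) : R :=
  MvPolynomial.X 0 ^ (β₁ - 1) * MvPolynomial.X 1 ^ (β₂ - 1) *
    gPoly m (Y.map (algebraMap ℝ ℂ)) ^ β₃

theorem betaWeight_mem_algR (h : Admissible f m Y) (β₁ β₂ β₃ : ℕ) :
    betaWeight m Y β₁ β₂ β₃ ∈ algR :=
  mul_mem (mul_mem (pow_mem (X_mem_algR 0) _) (pow_mem (X_mem_algR 1) _))
    (pow_mem (gPoly_mem_algR h.m_pos h.Y_mem) _)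

theorem integrand_squareMap (hm : 0 < m) (hY : ∀ t ∈ Set.Ioc (0 : ℝ) 1, 0 < Y.eval t)
    {β₁ β₂ : ℕ} (hβ₁ : 1 ≤ β₁) (hβ₂ : 1 ≤ β₂) (β₃ : ℕ) (s : ℂ) {x : ℝ × ℝ} (hx : x ∈ square) :
    integrand f m Y β₁ β₂ β₃ s (squareMap m Y x) =
      ev (betaWeight m Y β₁ β₂ β₃) (x.1 ^ m) (x.2 * Y.eval x.1) *
        (evR f (x.1 ^ m) (x.2 * Y.eval x.1) : ℂ) ^ s := by
  have ht := hx.1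
  have hg : gY m Y (squareMap m Y x) =
      ev (gPoly m (Y.map (algebraMap ℝ ℂ))) (x.1 ^ m) (x.2 * Y.eval x.1) := by
    rw [ev_gPoly hm, gY]
    refine Finset.prod_congr rfl fun ζ _ => ?_
    simp only [squareMap, rpow_one_div_pow hm ht.1.le]
    rw [Polynomial.eval_map_algebraMap]
  have hx0 : ((x.1 ^ m : ℝ) : ℂ) ≠ 0 := by exact_mod_cast (pow_pos ht.1 m).ne'
  have hy0 : ((x.2 * Y.eval x.1 : ℝ) : ℂ) ≠ 0 := by
    exact_mod_cast (mul_pos hx.2.1 (hY _ ht)).ne'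
  rw [integrand, hg, betaWeight, ev_mul, ev_mul,
    show ∀ (q : R) (k : ℕ) (a b : ℝ), ev (q ^ k) a b = ev q a b ^ k from
      fun q k a b => map_pow _ _ _,
    show ∀ (q : R) (k : ℕ) (a b : ℝ), ev (q ^ k) a b = ev q a b ^ k from
      fun q k a b => map_pow _ _ _,
    show ∀ (q : R) (k : ℕ) (a b : ℝ), ev (q ^ k) a b = ev q a b ^ k from
      fun q k a b => map_pow _ _ _]
  have e0 : ∀ a b : ℝ, ev (MvPolynomial.X 0) a b = a := fun a b => by simp [ev]
  have e1 : ∀ a b : ℝ, ev (MvPolynomial.X 1) a b = b := fun a b => by simp [ev]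
  rw [e0, e1]
  obtain ⟨a, rfl⟩ := Nat.exists_eq_add_of_le' hβ₁
  obtain ⟨b, rfl⟩ := Nat.exists_eq_add_of_le' hβ₂
  simp only [squareMap, Nat.add_sub_cancel, evR] at hx0 hy0 ⊢
  rw [pow_succ, pow_succ]
  field_simp

theorem integral_integrand (h : Admissible f m Y) (hY : ∀ t ∈ Set.Ioc (0 : ℝ) 1, 0 < Y.eval t)
    {β₁ β₂ : ℕ} (hβ₁ : 1 ≤ β₁) (hβ₂ : 1 ≤ β₂) (β₃ : ℕ) {s : ℂ} (hs : 0 < s.re) :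
    IntegrableOn (integrand f m Y β₁ β₂ β₃ s) (domainD m Y) ∧
      ∫ p in domainD m Y, integrand f m Y β₁ β₂ β₃ s p =
        weightIntegral f m Y (betaWeight m Y β₁ β₂ β₃) s := by
  have hae := domainD_ae_eq_image h.m_pos hY
  have hinj := injOn_squareMap h.m_pos hY
  have hd : ∀ x ∈ square, HasFDerivWithinAt (squareMap m Y) (squareMapDeriv m Y x) square x :=
    fun x _ => (hasFDerivAt_squareMap x).hasFDerivWithinAt
  have hpt : ∀ x ∈ square, |(squareMapDeriv m Y x).det| •
      integrand f m Y β₁ β₂ β₃ s (squareMap m Y x) =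
      (ev ((Polynomial.C (betaWeight m Y β₁ β₂ β₃)).eval (MvPolynomial.C s)) (x.1 ^ m)
        (x.2 * Y.eval x.1) * (evR f (x.1 ^ m) (x.2 * Y.eval x.1) : ℂ) ^ (s - (0 : ℕ))) *
        ((m * x.1 ^ (m - 1) * Y.eval x.1 : ℝ) : ℂ) := by
    intro x hx
    rw [integrand_squareMap h.m_pos hY hβ₁ hβ₂ β₃ s hx, det_squareMapDeriv, abs_of_nonneg
      (mul_nonneg (mul_nonneg (Nat.cast_nonneg m) (pow_nonneg hx.1.1.le _)) (hY _ hx.1).le),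
      Complex.real_smul, Polynomial.eval_C, Nat.cast_zero, sub_zero, mul_comm]
  constructor
  · rw [integrableOn_congr_set_ae hae,
      integrableOn_image_iff_integrableOn_abs_det_fderiv_smul volume measurableSet_square hd hinj]
    exact (integrableOn_squareIntegral _ 0 (by simpa using hs)).congr_fun
      (fun x hx => (hpt x hx).symm) measurableSet_square
  · rw [setIntegral_congr_set hae,
      integral_image_eq_integral_abs_det_fderiv_smul volume measurableSet_square hd hinj]
    exact setIntegral_congr_fun measurableSet_square hpt

theorem isContinuation_of_weightIntegral (h : Admissible f m Y)
    (hY : ∀ t ∈ Set.Ioc (0 : ℝ) 1, 0 < Y.eval t) {β₁ β₂ : ℕ} (hβ₁ : 1 ≤ β₁) (hβ₂ : 1 ≤ β₂)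
    (β₃ : ℕ) {G : ℂ → ℂ} (hG : Meromorphic G) {σ : ℝ}
    (hσ : ∀ s : ℂ, σ < s.re → weightIntegral f m Y (betaWeight m Y β₁ β₂ β₃) s = G s) :
    IsContinuation f m Y β₁ β₂ β₃ G := by
  refine ⟨hG, max 0 σ, fun s hs => ?_⟩
  rw [max_lt_iff] at hs
  obtain ⟨h1, h2⟩ := integral_integrand h hY hβ₁ hβ₂ β₃ hs.1
  exact ⟨h1, by rw [h2, hσ s hs.2]⟩

theorem weightIntegral_eq_sum (w : R) {s : ℂ} (hs : 0 < s.re) :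
    weightIntegral f m Y w s = ∑ d ∈ w.support,
      w.coeff d * weightIntegral f m Y (betaWeight m Y (d 0 + 1) (d 1 + 1) 0) s := by
  have hw : Polynomial.C w = ∑ d ∈ w.support, (Polynomial.C (w.coeff d)).map MvPolynomial.C *
      Polynomial.C (betaWeight m Y (d 0 + 1) (d 1 + 1) 0) := by
    conv_lhs => rw [w.as_sum]
    rw [map_sum]
    refine Finset.sum_congr rfl fun d _ => ?_
    rw [Polynomial.map_C, ← Polynomial.C_mul, MvPolynomial.monomial_eq, betaWeight,
      Finsupp.prod_fintype _ _ (fun i => pow_zero _), Fin.prod_univ_two]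
    simp
  rw [weightIntegral, hw, squareIntegral_sum _ _ _ (by simpa using hs)]
  refine Finset.sum_congr rfl fun d _ => ?_
  rw [squareIntegral_const_mul, Polynomial.eval_C, weightIntegral]

/-! ### The degenerate domains -/

theorem isCompact_domainD (hY : MonotoneOn (fun t : ℝ => Y.eval t) (Set.Ici 0)) :
    IsCompact (domainD m Y) := by
  have hr : Continuous fun p : ℝ × ℝ => p.1 ^ ((1 : ℝ) / m) :=
    (Real.continuous_rpow_const (by positivity)).comp continuous_fst
  refine (isCompact_Icc (a := (0 : ℝ)) (b := 1) |>.prod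
    (isCompact_Icc (a := (0 : ℝ)) (b := Y.eval 1))).of_isClosed_subset ?_ ?_
  · refine (isClosed_le continuous_const continuous_fst).inter
      ((isClosed_le continuous_fst continuous_const).inter
        ((isClosed_le continuous_const continuous_snd).inter
          (isClosed_le continuous_snd (Y.continuous.comp hr))))
  · rintro p ⟨h1, h2, h3, h4⟩
    refine ⟨⟨h1, h2⟩, h3, h4.trans ?_⟩
    exact hY (Real.rpow_nonneg h1 _) (Set.mem_Ici.2 zero_le_one)
      (Real.rpow_le_one h1 h2 (by positivity))

/-- If `f` is positive on all of a compact domain, then the integral has no poles. -/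
theorem not_hasPole_of_pos (hD : IsCompact (domainD m Y))
    (hpos : ∀ p ∈ domainD m Y, 0 < evR f p.1 p.2) {β₁ β₂ β₃ : ℕ} {F : ℂ → ℂ}
    (hF : IsContinuation f m Y β₁ β₂ β₃ F) (α : ℂ) : ¬ HasPole F α := by
  obtain ⟨hFm, σ, hσ⟩ := hF
  have hcont : ∀ z : ℂ, ContinuousOn (fun p : ℝ × ℝ => (evR f p.1 p.2 : ℂ) ^ z) (domainD m Y) :=
    fun z => ContinuousOn.cpow_const
      (Complex.continuous_ofReal.comp (continuous_evR f continuous_fst continuous_snd)).continuousOn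
      fun p hp => Complex.ofReal_mem_slitPlane.2 (hpos p hp)
  have hDm := hD.isClosed.measurableSet
  have hsplit : ∀ s p, integrand f m Y β₁ β₂ β₃ s p =
      (evR f p.1 p.2 : ℂ) ^ s * integrand f m Y β₁ β₂ β₃ 0 p := fun s p => by
    simp only [integrand, evR, Complex.cpow_zero]
    ring
  have hW : IntegrableOn (integrand f m Y β₁ β₂ β₃ 0) (domainD m Y) := by
    have h1 := (hσ ((σ + 1 : ℝ) : ℂ) (by rw [Complex.ofReal_re]; linarith)).1
    refine (h1.continuousOn_mul (hcont (-((σ + 1 : ℝ) : ℂ))) hD).congr_fun (fun p hp => ?_) hDm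
    have hne : (evR f p.1 p.2 : ℂ) ≠ 0 := by exact_mod_cast (hpos p hp).ne'
    simp only
    rw [hsplit, ← mul_assoc, ← Complex.cpow_add _ _ hne, neg_add_cancel, Complex.cpow_zero, one_mul]
  have key := differentiableOn_integral_cpow (μ := volume.restrict (domainD m Y))
    (p := fun p : ℝ × ℝ => evR f p.1 p.2) (W := integrand f m Y β₁ β₂ β₃ 0) (S := Set.univ)
    (continuous_evR f continuous_fst continuous_snd).measurable hW.aestronglyMeasurable ?_
    isOpen_univ (fun τ _ => hW.continuousOn_mul (hcont τ) hD)
  · have hent : Differentiable ℂ fun s : ℂ => ∫ p in domainD m Y,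
        (evR f p.1 p.2 : ℂ) ^ s * integrand f m Y β₁ β₂ β₃ 0 p := by
      rw [← differentiableOn_univ]
      simpa using key
    refine ((hent.analyticAt α).simplePoleAt.congr ?_).not_hasPole
    refine eventuallyEq_of_meromorphic (σ := σ) hFm (fun z => (hent.analyticAt z).meromorphicAt)
      (fun s hs => ?_) α
    rw [(hσ s hs).2]
    simp only [hsplit s]
  · filter_upwards [ae_restrict_mem hDm] with p hp using hpos p hp

/-- If `Y` vanishes identically, then `D_Y` is a null set and the integral is zero. -/
theorem not_hasPole_of_zero {β₁ β₂ β₃ : ℕ} {F : ℂ → ℂ}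
    (hF : IsContinuation f m 0 β₁ β₂ β₃ F) (α : ℂ) : ¬ HasPole F α := by
  obtain ⟨hFm, σ, hσ⟩ := hF
  have hnull : volume (domainD m 0) = 0 := by
    have hsub : domainD m 0 ⊆ Set.univ ×ˢ {(0 : ℝ)} := by
      rintro p ⟨-, -, h3, h4⟩
      rw [Polynomial.eval_zero] at h4
      exact ⟨trivial, le_antisymm h4 h3⟩
    refine measure_mono_null hsub ?_
    rw [Measure.volume_eq_prod, Measure.prod_prod]
    simp
  have han : AnalyticAt ℂ (fun _ : ℂ => (0 : ℂ)) α := analyticAt_const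
  refine (han.simplePoleAt.congr ?_).not_hasPole
  refine eventuallyEq_of_meromorphic (σ := σ) hFm (fun z => analyticAt_const.meromorphicAt)
    (fun s hs => ?_) α
  rw [(hσ s hs).2, setIntegral_measure_zero _ hnull]

/-- A monotone `Y` that is not positive on `(0, 1]` gives an integral without poles. -/
theorem not_hasPole_of_degenerate (hY : MonotoneOn (fun t : ℝ => Y.eval t) (Set.Ici 0))
    (hYpos : ¬ ∀ t ∈ Set.Ioc (0 : ℝ) 1, 0 < Y.eval t) (hm : 0 < m)
    (hpos : ∀ x y : ℝ, (x, y) ∈ domainD m Y → (x, y) ≠ (0, 0) → 0 < evR f x y)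
    {β₁ β₂ β₃ : ℕ} {F : ℂ → ℂ} (hF : IsContinuation f m Y β₁ β₂ β₃ F) (α : ℂ) :
    ¬ HasPole F α := by
  push Not at hYpos
  obtain ⟨t₁, ht₁, hYt₁⟩ := hYpos
  rcases lt_or_ge (Y.eval 0) 0 with h0 | h0
  · refine not_hasPole_of_pos (isCompact_domainD hY) (fun p hp => hpos p.1 p.2 hp ?_) hF α
    rintro h
    have hp' : p = (0, 0) := h
    obtain ⟨-, -, h3, h4⟩ := hp
    rw [hp'] at h3 h4
    simp only at h3 h4
    rw [Real.zero_rpow (by positivity)] at h4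
    linarith
  · have hzero : Y = 0 := by
      refine Polynomial.eq_zero_of_infinite_isRoot Y ((Set.Ioo_infinite ht₁.1).mono fun t ht => ?_)
      have h1 : Y.eval 0 ≤ Y.eval t := hY (Set.mem_Ici.2 le_rfl) (Set.mem_Ici.2 ht.1.le) ht.1.le
      have h2 : Y.eval t ≤ Y.eval t₁ :=
        hY (Set.mem_Ici.2 ht.1.le) (Set.mem_Ici.2 ht₁.1.le) ht.2.le
      exact le_antisymm (h2.trans hYt₁) (h0.trans h1)
    subst hzero
    exact not_hasPole_of_zero hF α

/-! ### Poles of the integrals and roots of the Bernstein-Sato polynomial -/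

theorem ofReal_mem_Qbar {K : IntermediateField ℚ ℝ} (hK : Algebra.IsAlgebraic ℚ K) {c : ℝ}
    (hc : c ∈ K) : (c : ℂ) ∈ Qbar := by
  rw [mem_algebraicClosure_iff]
  have h1 : IsAlgebraic ℚ (⟨c, hc⟩ : K) := hK.isAlgebraic _
  have h2 : IsAlgebraic ℚ (algebraMap K ℝ ⟨c, hc⟩) := h1.algebraMap
  exact (h2.algebraMap : IsAlgebraic ℚ (algebraMap ℝ ℂ c))

theorem admissible_of_pos {K : IntermediateField ℚ ℝ} (hK : Algebra.IsAlgebraic ℚ K)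
    (hm : 0 < m) (hfK : ∀ d, f.coeff d ∈ K) (hYK : ∀ k, Y.coeff k ∈ K)
    (hY : ∀ t ∈ Set.Ioc (0 : ℝ) 1, 0 < Y.eval t)
    (hpos : ∀ x y : ℝ, (x, y) ∈ domainD m Y → (x, y) ≠ (0, 0) → 0 < evR f x y) :
    Admissible f m Y where
  m_pos := hm
  f_mem := mem_algR_iff.2 fun d => by
    rw [toC, MvPolynomial.coeff_map]
    exact ofReal_mem_Qbar hK (hfK d)
  Y_mem := mem_algPoly_iff.2 fun k => by
    rw [Polynomial.coeff_map]
    exact ofReal_mem_Qbar hK (hYK k)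
  pos t ht v hv := by
    refine hpos _ _ ⟨pow_nonneg ht.1.le m, pow_le_one₀ ht.1.le ht.2, ?_, ?_⟩ ?_
    · exact mul_nonneg hv.1 (hY t ht).le
    · simp only [rpow_one_div_pow hm ht.1.le]
      exact mul_le_of_le_one_left (hY t ht).le hv.2
    · intro h
      exact (pow_pos ht.1 m).ne' (congrArg Prod.fst h)
  pos_left h0 v hv := by
    have hY0 : 0 < Y.eval 0 := by
      refine lt_of_le_of_ne (ge_of_tendsto (f := fun t : ℝ => Y.eval t) (x := 𝓝[>] 0)
        (Y.continuous.tendsto 0 |>.mono_left nhdsWithin_le_nhds) ?_) (Ne.symm h0)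
      filter_upwards [Ioc_mem_nhdsGT zero_lt_one] with t ht using (hY t ht).le
    refine hpos _ _ ⟨le_rfl, zero_le_one, mul_nonneg hv.1.le hY0.le, ?_⟩ ?_
    · simp only
      rw [Real.zero_rpow (by positivity)]
      exact mul_le_of_le_one_left hY0.le hv.2
    · intro h
      exact (mul_pos hv.1 hY0).ne' (congrArg Prod.snd h)

end BernsteinTwoPairs

open BernsteinTwoPairs in
theorem mainTheorem2
    (K : IntermediateField ℚ ℝ) (hK : Algebra.IsAlgebraic ℚ K)
    (n₁ n₂ m q : ℕ) (hn₁ : 1 < n₁) (hm : n₁ < m) (hmn₁ : Nat.Coprime m n₁)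
    (hq : 0 < q) (hn₂ : 1 < n₂) (hqn₂ : Nat.Coprime q n₂)
    (f g : MvPolynomial (Fin 2) ℝ) (Y : Polynomial ℝ)
    (hfK : ∀ d, f.coeff d ∈ K) (hYK : ∀ k, Y.coeff k ∈ K)
    (hf : HasCharSequence (toC f) (n₁ * n₂) [m * n₂, m * n₂ + q])
    (hmono : MonodromyHasDistinctEigenvalues (toC f))
    (hg : HasMaximalContact (toC f) (toC g) n₁ [m])
    (hYroot : ∃ P : Polynomial ℝ, P ^ n₁ = Y)
    (hY : (((m * n₁ * n₂ + q : ℕ) : ℕ∞) <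
          n₂ * (MvPolynomial.aeval ![(PowerSeries.X : PowerSeries ℝ) ^ m, (Y : PowerSeries ℝ)]
            g).order ∧
        MonotoneOn (fun t : ℝ => Y.eval t) (Set.Ici 0)) ∨
      Y = 1)
    (hpos : ∀ x y : ℝ, (x, y) ∈ domainD m Y → (x, y) ≠ (0, 0) →
      0 < MvPolynomial.eval ![x, y] f)
    (β₁ β₂ β₃ : ℕ) (hβ₁ : 1 ≤ β₁) (hβ₂ : 1 ≤ β₂)
    (F : ℂ → ℂ) (hF : IsContinuation f m Y β₁ β₂ β₃ F)
    (α ρ : ℂ) (hpole : HasPole F α) (hres : HasResidue F α ρ) (hρ : Transcendental ℚ ρ)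
    (hα : ∀ β₁' β₂' β₃' : ℕ, 1 ≤ β₁' → 1 ≤ β₂' →
      ∀ G : ℂ → ℂ, IsContinuation f m Y β₁' β₂' β₃' G → ¬ HasPole G (α + 1)) :
    (bernsteinSato (toC f)).IsRoot α := by
  have hm0 : 0 < m := by omega
  by_cases hYpos : ∀ t ∈ Set.Ioc (0 : ℝ) 1, 0 < Y.eval t
  swap
  · rcases hY with ⟨-, hmon⟩ | rfl
    · exact absurd hpole (not_hasPole_of_degenerate hmon hYpos hm0 hpos hF α)
    · exact absurd (fun t _ => by simp) hYpos
  by_contra hroot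
  have hadm : Admissible f m Y := admissible_of_pos hK hm0 hfK hYK hYpos hpos
  set B₀ := Submodule.IsPrincipal.generator (bernsteinIdeal (toC f)) with hB₀
  have hB₀α : B₀.eval α ≠ 0 := by
    intro h
    refine hroot ?_
    rw [bernsteinSato, normalize_apply, Polynomial.IsRoot.def, Polynomial.eval_mul, ← hB₀, h,
      zero_mul]
  have hf0 : toC f ≠ 0 := by
    intro h
    have h1 := hadm.pos 1 (by simp) 1 (by simp)
    have h2 := ev_toC f (1 ^ m) (1 * Y.eval 1)
    rw [h, ev, map_zero] at h2
    exact h1.ne (by exact_mod_cast h2)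
  obtain ⟨B, hBQ, hBα, P, t, N, hP, hN, hfe⟩ := exists_algebraic_functional_equation hf0 hadm.f_mem
    (Submodule.IsPrincipal.generator_mem (bernsteinIdeal (toC f))) hB₀α
  have hB : AlgFunctionalEquation (toC f) B P t N := ⟨hBQ, hP, hN, hfe⟩
  have hB0 : B ≠ 0 := by rintro rfl; simp at hBα
  have hnopole : ∀ w ∈ algR, ∀ G : ℂ → ℂ, Meromorphic G →
      (∃ σ : ℝ, ∀ s : ℂ, σ < s.re → weightIntegral f m Y w s = G s) →
        SimplePoleAt G (α + 1) 0 := by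
    rintro w _ G hG ⟨σ, hσ⟩
    choose H hH τ hτ using fun d : Fin 2 →₀ ℕ => exists_meromorphic_continuation hadm hB hB0
      (betaWeight_mem_algR hadm (d 0 + 1) (d 1 + 1) 0)
    have hHα : ∀ d, SimplePoleAt (fun s => w.coeff d * H d s) (α + 1) 0 := fun d => by
      have h1 := hα (d 0 + 1) (d 1 + 1) 0 (by omega) (by omega) (H d)
        (isContinuation_of_weightIntegral hadm hYpos (by omega) (by omega) 0 (hH d) (hτ d))
      simpa using (SimplePoleAt.of_not_hasPole (hH d _) h1).analytic_mul
        (p := fun _ => w.coeff d) analyticAt_const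
    have hsum : SimplePoleAt (fun s => ∑ d ∈ w.support, w.coeff d * H d s) (α + 1) 0 := by
      induction w.support using Finset.induction_on with
      | empty => simpa using (analyticAt_const (v := (0 : ℂ))).simplePoleAt
      | insert a t ha ih => simpa [Finset.sum_insert ha] using (hHα a).add ih
    obtain ⟨T, hT⟩ := (w.support.image τ).bddAbove
    refine hsum.congr (eventuallyEq_of_meromorphic (σ := max σ (max 0 T)) hG (fun z => ?_)
      (fun s hs => ?_) _)
    · exact MeromorphicAt.fun_sum fun d _ => analyticAt_const.meromorphicAt.mul (hH d z)
    · rw [max_lt_iff, max_lt_iff] at hs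
      rw [← hσ s hs.1, weightIntegral_eq_sum w hs.2.1]
      refine Finset.sum_congr rfl fun d hd => ?_
      rw [hτ d s]
      exact (hT (Finset.mem_coe.2 (Finset.mem_image_of_mem τ hd))).trans_lt hs.2.2
  obtain ⟨hFm, σ, hσ⟩ := hF
  obtain ⟨r, hr, hFr⟩ := isAlgebraic_residue hadm hB hBα hnopole
    (betaWeight_mem_algR hadm β₁ β₂ β₃) hFm ⟨max 0 σ, fun s hs => by
      rw [max_lt_iff] at hs
      rw [(hσ s hs.2).2, (integral_integrand hadm hYpos hβ₁ hβ₂ β₃ hs.1).2]⟩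
  rw [hFr.residue_unique hres] at hρ
  exact hρ (mem_algebraicClosure_iff.1 hr)
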